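/- Let $G$ be an $n$-vertex $r$-regular finite simple graph that is neither bipartite nor an $n$-cycle, and let $\mathcal N_i$ be the set of neighbours of the vertex $i$. The anti-voter chain on $G$ is the Markov chain $J^{(t)}=(J_i^{(t)})_i\in\{0,1\}^n$, $t\in\mathbb N$, with this transition: choose a vertex $i$ uniformly at random, then a vertex $j\in\mathcal N_i$ uniformly at random, put $J_i^{(t+1)}=1-J_j^{(t)}$, and leave all other opinions unchanged. Let the chain be in equilibrium (the law of $J^{(t)}$ does not depend on $t$). Write $J_i=J_i^{(0)}$, $W=\sum_iJ_i$, $W'=\sum_iJ_i^{(1)}$, $\mu=\mathbb EW$, $\sigma^2=\operatorname{Var}W$ with $\sigma\ge 0$, $S=\mathbb P[W'=W+1\mid W]$, $q_{\max}=\max_{k\in\mathbb Z}\mathbb P[W=k]$, $\lambda=2/n$ and $$Q=\sum_{i}\sum_{j\in\mathcal N_i}(2J_i-1)(2J_j-1).$$ Let $\mathrm{TP}(\mu,\sigma^2)$ be the law of an integer-valued $Y$ such that $Y-\mu+\sigma^2+\gamma$ is Poisson distributed with mean $\sigma^2+\gamma$, where $\gamma=(\mu-\sigma^2)-\lfloor\mu-\sigma^2\rfloor$.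 For probability measures $P_1,P_2$ on $\mathbb Z$ put $d_{\mathrm{TV}}(P_1,P_2)=\sup_{A\subset\mathbb Z}|P_1(A)-P_2(A)|$ and $d_{\mathrm{loc}}(P_1,P_2)=\sup_{k\in\mathbb Z}|P_1(\{k\})-P_2(\{k\})|$. Then $\sigma>0$, $0<\lambda<1$, the pair $(W,W')$ is exchangeable, almost surely $\mathbb E[W'-\mu\mid W]=(1-\lambda)(W-\mu)$ and $W'-W\in\{-1,0,1\}$, and $$d_{\mathrm{TV}}(\mathcal L(W),\mathrm{TP}(\mu,\sigma^2))\le\frac{\sqrt{\operatorname{Var}S}}{\lambda\sigma^2}+\frac{2}{\sigma^2},\qquad d_{\mathrm{loc}}(\mathcal L(W),\mathrm{TP}(\mu,\sigma^2))\le\frac{2\sqrt{q_{\max}\operatorname{Var}S}}{\lambda\sigma^2}+\frac{2}{\sigma^2}.$$ Moreover $$\operatorname{Var}S\le\frac{16r^2\sigma^2+\operatorname{Var}Q}{16r^2n^2}.$$ Consequently there is an absolute constant $C$, independent of $n$, $r$ and $G$, such that $$d_{\mathrm{TV}}(\mathcal L(W),\mathrm{TP}(\mu,\sigma^2))\le C\left(\frac{\sqrt{\operatorname{Var}Q}}{r\sigma^2}+\frac1\sigma\right),\qquad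 d_{\mathrm{loc}}(\mathcal L(W),\mathrm{TP}(\mu,\sigma^2))\le C\left(\frac{(\operatorname{Var}Q)^{3/4}}{r^{3/2}\sigma^3}+\frac1{\sigma^{3/2}}\right).$$ -/

import Mathlib

open MeasureTheory ProbabilityTheory

noncomputable section

/-- One-step transition probability of the anti-voter chain from `x` to `y`: choose a vertex `i`
uniformly at random, then a neighbour `j` of `i` uniformly at random, and replace the opinion of `i`
by the opposite of the opinion of `j`.  Opinion `1` is `true`, opinion `0` is `false`. -/
def antiVoterTransition {V : Type*} [Fintype V] [DecidableEq V] (G : SimpleGraph V)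
    [DecidableRel G.Adj] (x y : V → Bool) : ℝ :=
  (1 / (Fintype.card V : ℝ)) * ∑ i : V, (1 / (G.degree i : ℝ)) *
    ∑ j ∈ G.neighborFinset i, if Function.update x i (!x j) = y then (1 : ℝ) else 0

/-- `J` is the anti-voter chain on `G`, in equilibrium, on the probability space `(Ω, P)`: it is a
time-homogeneous Markov chain with the anti-voter transition probabilities, and the law of its
state does not change with time. -/
structure IsEquilibriumAntiVoter {V : Type*} [Fintype V] [DecidableEq V] (G : SimpleGraph V)
    [DecidableRel G.Adj] {Ω : Type*} [MeasurableSpace Ω] (P : Measure Ω)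
    (J : ℕ → Ω → V → Bool) : Prop where
  measurable : ∀ t, Measurable (J t)
  markov : ∀ (t : ℕ) (x : ℕ → V → Bool),
    P.real {ω | ∀ s ≤ t + 1, J s ω = x s} =
      P.real {ω | ∀ s ≤ t, J s ω = x s} * antiVoterTransition G (x t) (x (t + 1))
  stationary : ∀ t, P.map (J t) = P.map (J 0)

/-- The number of vertices with opinion `1`. -/
def oneCount {V : Type*} [Fintype V] (x : V → Bool) : ℤ :=
  ∑ i : V, ((x i).toNat : ℤ)

/-- `∑ i, ∑ j ∈ N_i, (2 x_i - 1) (2 x_j - 1)`. -/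
def neighbourProductSum {V : Type*} [Fintype V] (G : SimpleGraph V) [DecidableRel G.Adj]
    (x : V → Bool) : ℝ :=
  ∑ i : V, ∑ j ∈ G.neighborFinset i,
    (2 * ((x i).toNat : ℝ) - 1) * (2 * ((x j).toNat : ℝ) - 1)

/-- The translated Poisson distribution `TP(μ, v)`, for `0 ≤ v`: the law of `Y` such that
`Y - μ + v + γ = Y - ⌊μ - v⌋` has the Poisson distribution with mean `v + γ`,
where `γ` is the fractional part of `μ - v`. -/
def translatedPoisson (μ v : ℝ) : Measure ℤ :=
  (poissonMeasure (v + Int.fract (μ - v)).toNNReal).map (fun k : ℕ => (k : ℤ) + ⌊μ - v⌋)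

/-- Total variation distance of probability measures on `ℤ`. -/
def tvDistInt (P Q : Measure ℤ) : ℝ :=
  ⨆ A : Set ℤ, |P.real A - Q.real A|

/-- Local limit metric for probability measures on `ℤ`. -/
def locDistInt (P Q : Measure ℤ) : ℝ :=
  ⨆ k : ℤ, |P.real {k} - Q.real {k}|

/-- The largest point probability of a probability measure on `ℤ`. -/
def maxPointProb (P : Measure ℤ) : ℝ :=
  ⨆ k : ℤ, P.real {k}

end

/-! The proof is Stein's method for the translated Poisson law, followed by a symmetry argument for
the variance of `S`.

In equilibrium `W` and `W'` have the same law, and `W` moves by at most one. The probabilities of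
crossing a level upwards and downwards are therefore equal, which makes `(W, W')` exchangeable
without any reversibility of the chain (`map_prodMk_comm_of_skipFree`). With the linear regression
this gives `λ 𝔼[(W - μ) g(W)] = 𝔼[S (g(W + 1) - g(W))]` for every `g`
(`isSteinPair_of_exchangeable`). Let `g` solve the Poisson Stein equation for a set `A`, shifted by
`⌊μ - σ²⌋`. The difference of the two probabilities of `A` becomes `-λ⁻¹ 𝔼[(S - 𝔼 S) Δg(W)]`, plus a
rounding term `γ 𝔼[Δg(W)]`, plus a term carried by the event that `W` lies below the support of the
translated Poisson law; the last two cost `1/σ²` each (`abs_measureReal_sub_translatedPoisson_le`).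
Cauchy–Schwarz with `|Δg| ≤ 1/σ²` gives the total variation bound. For a point, `∑ (Δg)² ≤ 2/σ⁴`,
which gains the factor `√q_max`.

For `Var S`, the probability of an up-step given the whole state is affine in the total spin `U = 2W
- n` and in `Q`, and conditioning on `W` only lowers the variance. It remains to see that `U` and
`Q` are uncorrelated. The graph may be disconnected and the equilibrium not unique, so a global
reversal of opinions is not enough. Instead opinions are reversed on the components that contain an
odd closed walk. Every equilibrium law is invariant under this (`stationary_flipOdd`), and it
preserves `Q`. It also negates `U`, because on the bipartite components an equilibrium state
alternates and contributes nothing to `U` (`stationary_totalSpin_flipOdd`).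

The rates follow by inserting the variance bound and a bound on `q_max` from the Stein identity; for
`σ < 1` they are trivial, as both distances are at most `1`. -/

noncomputable section

/-! ### The Poisson Stein equation and its difference bounds -/

/-- The solution vanishing at `0` of the Poisson Stein equation
`Λ g (k + 1) - k g k = h k / p k - ∑' i, h i`, where `p` is the Poisson mass function. -/
def poissonSteinSolution (p h : ℕ → ℝ) (Λ : ℝ) : ℕ → ℝ
  | 0 => 0
  | k + 1 => (∑ i ∈ Finset.range (k + 1), h i -
      (∑' i, h i) * ∑ i ∈ Finset.range (k + 1), p i) / (Λ * p k)

section PoissonStein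

variable {p : ℕ → ℝ} {Λ : ℝ}

theorem poissonSteinSolution_equation (hΛ : 0 < Λ) (hp : ∀ k, 0 < p k)
    (hrec : ∀ k : ℕ, ((k : ℝ) + 1) * p (k + 1) = Λ * p k) (h : ℕ → ℝ) (k : ℕ) :
    Λ * poissonSteinSolution p h Λ (k + 1) - k * poissonSteinSolution p h Λ k =
      h k / p k - ∑' i, h i := by
  cases k with
  | zero =>
    have := hp 0
    simp [poissonSteinSolution]
    field_simp
  | succ m =>
    have h0 := hp m
    have h1 := hp (m + 1)
    have hm : (0 : ℝ) < (m : ℝ) + 1 := by positivity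
    have e : Λ * p m = ((m : ℝ) + 1) * p (m + 1) := (hrec m).symm
    simp only [poissonSteinSolution]
    rw [e, Finset.sum_range_succ h (m + 1), Finset.sum_range_succ p (m + 1)]
    push_cast
    field_simp
    ring

/-- The ratio `p (k + 1) / p k = Λ / (k + 1)` decreases in `k`. -/
theorem poisson_ratio_antitone (hΛ : 0 < Λ) (hp : ∀ k, 0 < p k)
    (hrec : ∀ k : ℕ, ((k : ℝ) + 1) * p (k + 1) = Λ * p k) {m j : ℕ} (hmj : m ≤ j) :
    p (j + 1) * p m ≤ p j * p (m + 1) := by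
  have hmj' : (m : ℝ) ≤ j := by exact_mod_cast hmj
  have h1 := hrec m
  have h2 := hrec j
  have hj : (0 : ℝ) < (j : ℝ) + 1 := by positivity
  have key : Λ * (p (j + 1) * p m) ≤ Λ * (p j * p (m + 1)) := by
    calc Λ * (p (j + 1) * p m) = p (j + 1) * (Λ * p m) := by ring
      _ = ((m : ℝ) + 1) * (p (j + 1) * p (m + 1)) := by rw [← h1]; ring
      _ ≤ ((j : ℝ) + 1) * (p (j + 1) * p (m + 1)) := by
          have := mul_pos (hp (j + 1)) (hp (m + 1))
          gcongr
      _ = (Λ * p j) * p (m + 1) := by rw [← h2]; ring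
      _ = _ := by ring
  exact le_of_mul_le_mul_left key hΛ

/-- The difference is linear in `h`. By monotonicity of the ratios of `p`, the values of `h` away
from `k` enter with nonpositive coefficients, and `h k` with coefficient at most `1 / (Λ * p k)`. -/
theorem poissonSteinSolution_diff_le (hΛ : 0 < Λ) (hp : ∀ k, 0 < p k)
    (hrec : ∀ k : ℕ, ((k : ℝ) + 1) * p (k + 1) = Λ * p k) (hsum : HasSum p 1)
    {h : ℕ → ℝ} (h0 : ∀ i, 0 ≤ h i) (hle : ∀ i, h i ≤ p i) (k : ℕ) :
    poissonSteinSolution p h Λ (k + 1) - poissonSteinSolution p h Λ k ≤ h k / p k / Λ := by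
  have hs : Summable h := Summable.of_nonneg_of_le h0 hle hsum.summable
  cases k with
  | zero =>
    have := hp 0
    have hH : 0 ≤ ∑' i, h i := tsum_nonneg h0
    simp only [poissonSteinSolution, zero_add, Finset.sum_range_one, sub_zero]
    rw [div_div, mul_comm Λ]
    gcongr
    nlinarith
  | succ m =>
    set u := ∑ i ∈ Finset.range (m + 1), p i with hu
    set a := ∑ i ∈ Finset.range (m + 1), h i with ha
    set t := ∑' i, p (i + (m + 2)) with ht
    set b := ∑' i, h (i + (m + 2)) with hb
    have hP : u + p (m + 1) + t = 1 := by
      rw [hu, ht, ← Finset.sum_range_succ, hsum.summable.sum_add_tsum_nat_add (m + 2), hsum.tsum_eq]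
    have hH : ∑' i, h i = a + h (m + 1) + b := by
      rw [ha, hb, ← Finset.sum_range_succ, hs.sum_add_tsum_nat_add (m + 2)]
    have hsp' : Summable fun i => p (i + (m + 2)) := (summable_nat_add_iff (m + 2)).2 hsum.summable
    have hsp1 : Summable fun i => p (i + (m + 1)) := (summable_nat_add_iff (m + 1)).2 hsum.summable
    have ha0 : 0 ≤ a := Finset.sum_nonneg fun i _ => h0 i
    have hb0 : 0 ≤ b := tsum_nonneg fun i => h0 _
    have hu0 : 0 ≤ u := Finset.sum_nonneg fun i _ => (hp i).le
    have ht0 : 0 ≤ t := tsum_nonneg fun i => (hp _).le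
    have p0 := hp m
    have p1 := hp (m + 1)
    have hm : (0 : ℝ) < (m : ℝ) + 1 := by positivity
    have hr := hrec m
    have tail : t * p m ≤ (p (m + 1) + t) * p (m + 1) := by
      have e : p (m + 1) + t = ∑' i, p (i + (m + 1)) := by
        rw [hsp1.tsum_eq_zero_add, ht]
        simp only [zero_add]
        congr 2
        ext i
        congr 1
        omega
      rw [e, ht, ← tsum_mul_right, ← tsum_mul_right]
      refine (hsp'.mul_right _).tsum_le_tsum (fun i => ?_) (hsp1.mul_right _)
      exact poisson_ratio_antitone hΛ hp hrec (by omega : m ≤ i + (m + 1))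
    have head : u * p (m + 1) ≤ (u + p (m + 1)) * p m := by
      have e : u + p (m + 1) = ∑ i ∈ Finset.range (m + 1), p (i + 1) + p 0 := by
        rw [hu, ← Finset.sum_range_succ, Finset.sum_range_succ']
      rw [e, hu, add_mul, Finset.sum_mul, Finset.sum_mul]
      have : ∑ i ∈ Finset.range (m + 1), p i * p (m + 1) ≤
          ∑ i ∈ Finset.range (m + 1), p (i + 1) * p m := by
        refine Finset.sum_le_sum fun i hi => ?_
        have := poisson_ratio_antitone hΛ hp hrec (Nat.lt_succ_iff.1 (Finset.mem_range.1 hi))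
        nlinarith
      have := mul_pos (hp 0) (hp m)
      linarith
    have mid : t * p m + u * p (m + 1) ≤ p m := by
      have : u * p (m + 1) ≤ (1 - t) * p m := by
        have e : 1 - t = u + p (m + 1) := by linarith
        rw [e]; exact head
      linarith
    -- The sum of `h` is split at `m + 1`, and `u + p (m + 1) + t = 1`. Then `tail` and `head` give
    -- the signs of the terms in `a` and `b`, and `mid` bounds the factor of `h (m + 1)`.
    have expr : poissonSteinSolution p h Λ (m + 1 + 1) - poissonSteinSolution p h Λ (m + 1) =
        (h (m + 1) * (t * p m + u * p (m + 1)) - a * ((p (m + 1) + t) * p (m + 1) - t * p m)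
          - b * ((u + p (m + 1)) * p m - u * p (m + 1))) / (Λ * p m * p (m + 1)) := by
      simp only [poissonSteinSolution]
      rw [Finset.sum_range_succ h (m + 1), Finset.sum_range_succ p (m + 1), ← hu, ← ha, hH]
      have et : t = 1 - u - p (m + 1) := by linarith
      rw [et]
      field_simp
      ring
    rw [expr, div_div, div_le_div_iff₀ (by positivity) (by positivity)]
    have h1 : 0 ≤ a * ((p (m + 1) + t) * p (m + 1) - t * p m) := mul_nonneg ha0 (by linarith)
    have h2 : 0 ≤ b * ((u + p (m + 1)) * p m - u * p (m + 1)) := mul_nonneg hb0 (by linarith)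
    have h3 : h (m + 1) * (t * p m + u * p (m + 1)) ≤ h (m + 1) * p m :=
      mul_le_mul_of_nonneg_left mid (h0 _)
    have h4 : 0 < p (m + 1) * Λ := by positivity
    calc _ ≤ (h (m + 1) * p m) * (p (m + 1) * Λ) :=
          mul_le_mul_of_nonneg_right (by linarith) h4.le
      _ = _ := by ring

theorem poissonSteinSolution_compl (hsum : HasSum p 1) {h : ℕ → ℝ} (hs : Summable h) (k : ℕ) :
    poissonSteinSolution p (fun i => p i - h i) Λ k = -poissonSteinSolution p h Λ k := by
  cases k with
  | zero => simp [poissonSteinSolution]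
  | succ m =>
    simp only [poissonSteinSolution, Finset.sum_sub_distrib]
    rw [hsum.summable.tsum_sub hs, hsum.tsum_eq]
    ring

/-- Passing to `p - h` negates the solution, so the one-sided bound for the complement is the lower
bound. -/
theorem abs_poissonSteinSolution_diff_le (hΛ : 0 < Λ) (hp : ∀ k, 0 < p k)
    (hrec : ∀ k : ℕ, ((k : ℝ) + 1) * p (k + 1) = Λ * p k) (hsum : HasSum p 1)
    {h : ℕ → ℝ} (h0 : ∀ i, 0 ≤ h i) (hle : ∀ i, h i ≤ p i) (k : ℕ) :
    |poissonSteinSolution p h Λ (k + 1) - poissonSteinSolution p h Λ k| ≤ 1 / Λ := by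
  have hs : Summable h := Summable.of_nonneg_of_le h0 hle hsum.summable
  have h1 := poissonSteinSolution_diff_le hΛ hp hrec hsum h0 hle k
  have h2 := poissonSteinSolution_diff_le hΛ hp hrec hsum (h := fun i => p i - h i)
    (fun i => by linarith [hle i]) (fun i => by linarith [h0 i]) k
  rw [poissonSteinSolution_compl hsum hs, poissonSteinSolution_compl hsum hs] at h2
  have hb : ∀ y, y ≤ p k → y / p k / Λ ≤ 1 / Λ := fun y hy => by
    have := hp k
    gcongr
    rwa [div_le_one this]
  have := hb _ (hle k)
  have := hb (p k - h k) (by linarith [h0 k])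
  rw [abs_le]
  constructor <;> linarith

/-- For a point mass at `a` the solution starts at `0`, can increase only from `a` to `a + 1`, by at
most `1 / Λ`, and is nonnegative beyond `a`. Its total variation is thus at most `2 / Λ`; the
remaining factor `1 / Λ` is the uniform bound on differences. -/
theorem sum_sq_poissonSteinSolution_diff_le (hΛ : 0 < Λ) (hp : ∀ k, 0 < p k)
    (hrec : ∀ k : ℕ, ((k : ℝ) + 1) * p (k + 1) = Λ * p k) (hsum : HasSum p 1) (a N : ℕ) :
    ∑ k ∈ Finset.range N, (poissonSteinSolution p (Pi.single a (p a)) Λ (k + 1) -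
      poissonSteinSolution p (Pi.single a (p a)) Λ k) ^ 2 ≤ 2 / Λ ^ 2 := by
  set h : ℕ → ℝ := Pi.single a (p a) with hh
  set g := poissonSteinSolution p h Λ with hg
  have h0 : ∀ i, 0 ≤ h i := fun i => by
    by_cases hi : i = a
    · subst hi; simp [hh, (hp i).le]
    · simp [hh, Pi.single_eq_of_ne hi]
  have hle : ∀ i, h i ≤ p i := fun i => by
    by_cases hi : i = a
    · subst hi; simp [hh]
    · simp [hh, Pi.single_eq_of_ne hi, (hp i).le]
  have habs : ∀ k, |g (k + 1) - g k| ≤ 1 / Λ :=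
    abs_poissonSteinSolution_diff_le hΛ hp hrec hsum h0 hle
  have hneg : ∀ k, k ≠ a → g (k + 1) - g k ≤ 0 := fun k hk => by
    have := poissonSteinSolution_diff_le hΛ hp hrec hsum h0 hle k
    simpa [hh, Pi.single_eq_of_ne hk] using this
  have hlast : ∀ M, a < M → 0 ≤ g M := fun M hM => by
    obtain ⟨m, rfl⟩ : ∃ m, M = m + 1 := ⟨M - 1, by omega⟩
    have e1 : ∑ i ∈ Finset.range (m + 1), h i = p a := by
      rw [hh, Finset.sum_pi_single']
      simp [hM]
    have e2 : ∑' i, h i = p a := by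
      rw [hh, tsum_eq_single a (fun b hb => Pi.single_eq_of_ne hb _)]
      simp
    have e3 : ∑ i ∈ Finset.range (m + 1), p i ≤ 1 := sum_le_hasSum _ (fun i _ => (hp i).le) hsum
    simp only [hg, poissonSteinSolution, e1, e2]
    have := hp a
    have := hp m
    apply div_nonneg _ (by positivity)
    nlinarith
  have hmain : ∀ M, a < M → ∑ k ∈ Finset.range M, |g (k + 1) - g k| ≤ 2 / Λ := fun M hM => by
    have e : ∀ k ∈ Finset.range M, |g (k + 1) - g k| ≤
        -(g (k + 1) - g k) + if k = a then 2 / Λ else 0 := fun k _ => by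
      split_ifs with hk
      · have := habs k
        have h2 : 2 / Λ = 2 * (1 / Λ) := by ring
        have := abs_le.1 this
        rw [h2]
        linarith [habs k]
      · rw [abs_of_nonpos (hneg k hk)]; simp
    refine (Finset.sum_le_sum e).trans ?_
    rw [Finset.sum_add_distrib, Finset.sum_neg_distrib, Finset.sum_range_sub]
    have : g 0 = 0 := rfl
    rw [Finset.sum_ite_eq' ]
    simp only [Finset.mem_range, hM, if_true]
    linarith [hlast M hM]
  -- The range is extended beyond `a`, where the sign of `g M` is known.
  set M := max N (a + 1)
  calc _ ≤ ∑ k ∈ Finset.range M, (g (k + 1) - g k) ^ 2 :=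
        Finset.sum_le_sum_of_subset_of_nonneg
          (Finset.range_subset_range.2 (le_max_left _ _)) fun _ _ _ => sq_nonneg _
    _ ≤ ∑ k ∈ Finset.range M, 1 / Λ * |g (k + 1) - g k| := by
        refine Finset.sum_le_sum fun k _ => ?_
        rw [← sq_abs, sq]
        exact mul_le_mul_of_nonneg_right (habs k) (abs_nonneg _)
    _ ≤ 1 / Λ * (2 / Λ) := by
        rw [← Finset.mul_sum]
        exact mul_le_mul_of_nonneg_left (hmain M (by omega)) (by positivity)
    _ = _ := by ring

end PoissonStein

/-! ### Consequences of the Stein identity: mean, mean rate, point probabilities -/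

section SteinPair

variable {Ω : Type*} [MeasurableSpace Ω] {P : Measure Ω}

theorem abs_integral_mul_le_sqrt_mul_sqrt {f g : Ω → ℝ} (hf : MemLp f 2 P) (hg : MemLp g 2 P) :
    |∫ ω, f ω * g ω ∂P| ≤ √(∫ ω, f ω ^ 2 ∂P) * √(∫ ω, g ω ^ 2 ∂P) := by
  have hff := hf.integrable_sq
  have hgg := hg.integrable_sq
  have hfg : Integrable (fun ω => f ω * g ω) P := hf.integrable_mul hg
  have key : ∀ t : ℝ, 0 ≤ (∫ ω, g ω ^ 2 ∂P) * (t * t) + (2 * ∫ ω, f ω * g ω ∂P) * t +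
      ∫ ω, f ω ^ 2 ∂P := fun t => by
    have e : ∫ ω, (f ω + t * g ω) ^ 2 ∂P = (∫ ω, g ω ^ 2 ∂P) * (t * t) +
        (2 * ∫ ω, f ω * g ω ∂P) * t + ∫ ω, f ω ^ 2 ∂P := by
      have : (fun ω => (f ω + t * g ω) ^ 2) =
          fun ω => ((t * t) * g ω ^ 2 + (2 * t) * (f ω * g ω)) + f ω ^ 2 := by
        ext ω; ring
      have i1 : Integrable (fun ω => (t * t) * g ω ^ 2) P := hgg.const_mul _
      have i2 : Integrable (fun ω => (2 * t) * (f ω * g ω)) P := hfg.const_mul _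
      have i3 : Integrable (fun ω => (t * t) * g ω ^ 2 + (2 * t) * (f ω * g ω)) P := i1.add i2
      rw [this, integral_add i3 hff, integral_add i1 i2, integral_const_mul, integral_const_mul]
      ring
    rw [← e]
    exact integral_nonneg fun ω => sq_nonneg _
  have h := discrim_le_zero key
  rw [discrim] at h
  rw [← Real.sqrt_mul (integral_nonneg fun ω => sq_nonneg _)]
  apply Real.abs_le_sqrt
  linarith

theorem abs_integral_centered_mul_le [IsProbabilityMeasure P] {X f : Ω → ℝ} (hX : MemLp X 2 P)
    (hf : MemLp f 2 P) :
    |∫ ω, (X ω - ∫ ω', X ω' ∂P) * f ω ∂P| ≤ √(variance X P) * √(∫ ω, f ω ^ 2 ∂P) := by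
  rw [variance_eq_integral hX.1.aemeasurable]
  exact abs_integral_mul_le_sqrt_mul_sqrt (hX.sub (memLp_const _)) hf

theorem memLp_comp_of_abs_le [IsFiniteMeasure P] {W W' : Ω → ℤ} (hW : Measurable W)
    (hW' : Measurable W') {M : ℤ} (hM : ∀ ω, |W ω| ≤ M) (hM' : ∀ ω, |W' ω| ≤ M)
    (F : ℤ → ℤ → ℝ) (q : ENNReal) : MemLp (fun ω => F (W ω) (W' ω)) q P := by
  have hmeas : Measurable fun ω => F (W ω) (W' ω) :=
    (Measurable.of_discrete (f := fun x : ℤ × ℤ => F x.1 x.2)).comp (hW.prodMk hW')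
  refine MemLp.of_bound hmeas.aestronglyMeasurable
    (∑ a ∈ Finset.Icc (-M) M, ∑ b ∈ Finset.Icc (-M) M, ‖F a b‖) (ae_of_all _ fun ω => ?_)
  have h1 : W ω ∈ Finset.Icc (-M) M := Finset.mem_Icc.2 (abs_le.1 (hM ω))
  have h2 : W' ω ∈ Finset.Icc (-M) M := Finset.mem_Icc.2 (abs_le.1 (hM' ω))
  exact (Finset.single_le_sum (f := fun b => ‖F (W ω) b‖) (fun _ _ => norm_nonneg _) h2).trans
    (Finset.single_le_sum (f := fun a => ∑ b ∈ Finset.Icc (-M) M, ‖F a b‖)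
      (fun _ _ => Finset.sum_nonneg fun _ _ => norm_nonneg _) h1)

/-- The Stein identity `λ 𝔼[(W - μ) g(W)] = 𝔼[S (g(W + 1) - g(W))]` for a bounded integer-valued
random variable `W`. -/
structure IsSteinPair (P : Measure Ω) (W : Ω → ℤ) (S : Ω → ℝ) (μ lam : ℝ) : Prop where
  measurable : Measurable W
  bounded : ∃ M : ℤ, ∀ ω, |W ω| ≤ M
  memLp : MemLp S 2 P
  lam_pos : 0 < lam
  identity : ∀ g : ℤ → ℝ, lam * ∫ ω, ((W ω : ℝ) - μ) * g (W ω) ∂P =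
    ∫ ω, S ω * (g (W ω + 1) - g (W ω)) ∂P

namespace IsSteinPair

variable {W : Ω → ℤ} {S : Ω → ℝ} {μ lam : ℝ}

theorem memLp_comp [IsFiniteMeasure P] (h : IsSteinPair P W S μ lam) (F : ℤ → ℝ) (q : ENNReal) :
    MemLp (fun ω => F (W ω)) q P := by
  obtain ⟨M, hM⟩ := h.bounded
  exact memLp_comp_of_abs_le h.measurable h.measurable hM hM (fun a _ => F a) q

theorem integrable_comp [IsFiniteMeasure P] (h : IsSteinPair P W S μ lam) (F : ℤ → ℝ) :
    Integrable (fun ω => F (W ω)) P :=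
  memLp_one_iff_integrable.1 (h.memLp_comp F 1)

theorem integrable_mul_comp [IsFiniteMeasure P] (h : IsSteinPair P W S μ lam) (F : ℤ → ℝ) :
    Integrable (fun ω => S ω * F (W ω)) P :=
  h.memLp.integrable_mul (h.memLp_comp F 2)

variable [IsProbabilityMeasure P]

theorem integral_eq (h : IsSteinPair P W S μ lam) : ∫ ω, (W ω : ℝ) ∂P = μ := by
  have := h.identity fun _ => 1
  simp only [mul_one, sub_self, mul_zero, integral_zero, mul_eq_zero, h.lam_pos.ne',
    false_or] at this
  rw [integral_sub (h.integrable_comp fun w => (w : ℝ)) (integrable_const _)] at this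
  simp at this
  linarith

theorem integral_rate (h : IsSteinPair P W S μ lam) :
    ∫ ω, S ω ∂P = lam * variance (fun ω => (W ω : ℝ)) P := by
  have := h.identity fun w => (w : ℝ) - μ
  rw [variance_eq_integral (h.integrable_comp fun w => (w : ℝ)).1.aemeasurable, h.integral_eq]
  simp only [← sq] at this
  rw [this]
  congr 1
  ext ω
  push_cast
  ring

/-- The indicator of `(k, ∞)` has the indicator of `{k}` as its difference. Inserted into the Stein
identity, it bounds `𝔼[S; W = k]` by `lam * √v`; replacing `S` by its mean `lam * v` costs at most
`√(Var S)`. -/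
theorem pointProb_le (h : IsSteinPair P W S μ lam) (hv : 0 < variance (fun ω => (W ω : ℝ)) P)
    (k : ℤ) : (P.map W).real {k} ≤ 1 / √(variance (fun ω => (W ω : ℝ)) P) +
      √(variance S P) / (lam * variance (fun ω => (W ω : ℝ)) P) := by
  set v := variance (fun ω => (W ω : ℝ)) P with hvd
  have hl := h.lam_pos
  have hpk : (P.map W).real {k} = ∫ ω, (if W ω = k then (1 : ℝ) else 0) ∂P := by
    rw [map_measureReal_apply h.measurable (measurableSet_singleton k),
      ← integral_indicator_one (h.measurable (measurableSet_singleton k))]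
    congr 1
    ext ω
    by_cases hω : W ω = k <;> simp [Set.indicator, hω]
  have hid := h.identity fun w => if k < w then 1 else 0
  have e1 : ∀ w : ℤ, ((if k < w + 1 then (1 : ℝ) else 0) - if k < w then 1 else 0) =
      if w = k then 1 else 0 := fun w => by
    rcases lt_trichotomy w k with hw | hw | hw
    · simp [not_lt.2 hw.le, hw.ne, not_lt.2 (show w + 1 ≤ k by omega)]
    · simp [hw]
    · simp [hw, hw.ne', hw.trans (lt_add_one w)]
  simp only [e1] at hid
  have h1 := h.memLp_comp (fun w => if w = k then 1 else 0) 2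
  have h2 := h.memLp_comp (fun w => if k < w then 1 else 0) 2
  have c1 := abs_integral_centered_mul_le h.memLp h1
  have c2 := abs_integral_centered_mul_le (h.memLp_comp (fun w => (w : ℝ)) 2) h2
  have hone : ∀ q : ℤ → Prop, ∀ _ : DecidablePred q,
      √(∫ ω, (if q (W ω) then (1 : ℝ) else 0) ^ 2 ∂P) ≤ 1 := fun q _ => by
    refine Real.sqrt_le_iff.2 ⟨zero_le_one, ?_⟩
    rw [one_pow]
    calc _ ≤ ∫ _, (1 : ℝ) ∂P := by
          refine integral_mono (h.memLp_comp (fun w => if q w then 1 else 0) 2).integrable_sq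
            (integrable_const _) fun ω => ?_
          dsimp only
          split_ifs <;> simp
      _ = 1 := by simp
  have c1' := c1.trans (mul_le_of_le_one_right (Real.sqrt_nonneg _) (hone (· = k) inferInstance))
  have c2' := c2.trans (mul_le_of_le_one_right (Real.sqrt_nonneg _) (hone (k < ·) inferInstance))
  rw [h.integral_eq, ← hvd] at c2'
  rw [h.integral_rate] at c1'
  have e2 : ∫ ω, (S ω - lam * v) * (if W ω = k then (1 : ℝ) else 0) ∂P =
      (∫ ω, S ω * (if W ω = k then (1 : ℝ) else 0) ∂P) - lam * v * (P.map W).real {k} := by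
    rw [hpk, ← integral_const_mul,
      ← integral_sub (h.integrable_mul_comp fun w => if w = k then 1 else 0)
      ((h.integrable_comp fun w => if w = k then (1 : ℝ) else 0).const_mul _)]
    congr 1
    ext ω
    ring
  rw [e2, ← hid] at c1'
  have s0 : 0 < √v := Real.sqrt_pos.2 hv
  have s1 : √v * √v = v := Real.mul_self_sqrt hv.le
  have hA := (abs_le.1 c2').2
  have hB := (abs_le.1 c1').1
  have hC : lam * v * (P.map W).real {k} ≤ lam * √v + √(variance S P) := by
    have := mul_le_mul_of_nonneg_left hA hl.le
    linarith
  have e3 : 1 / √v + √(variance S P) / (lam * v) = (lam * √v + √(variance S P)) / (lam * v) := by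
    rw [add_div]
    congr 1
    rw [div_eq_div_iff s0.ne' (by positivity)]
    linear_combination (-lam) * s1
  rw [e3, le_div_iff₀ (by positivity)]
  linarith

theorem maxPointProb_le (h : IsSteinPair P W S μ lam)
    (hv : 0 < variance (fun ω => (W ω : ℝ)) P) :
    maxPointProb (P.map W) ≤ 1 / √(variance (fun ω => (W ω : ℝ)) P) +
      √(variance S P) / (lam * variance (fun ω => (W ω : ℝ)) P) :=
  ciSup_le (h.pointProb_le hv)

end IsSteinPair

end SteinPair

/-! ### Mass functions of the Poisson and translated Poisson laws -/

section TranslatedPoisson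

theorem translatedPoisson_real_apply (μ v : ℝ) (A : Set ℤ) :
    (translatedPoisson μ v).real A =
      (poissonMeasure (v + Int.fract (μ - v)).toNNReal).real {k : ℕ | (k : ℤ) + ⌊μ - v⌋ ∈ A} := by
  rw [translatedPoisson, map_measureReal_apply .of_discrete
    (DiscreteMeasurableSpace.forall_measurableSet A)]
  rfl

instance isProbabilityMeasure_translatedPoisson (μ v : ℝ) :
    IsProbabilityMeasure (translatedPoisson μ v) :=
  Measure.isProbabilityMeasure_map .of_discrete

theorem hasSum_measureReal_singleton (ν : Measure ℕ) [IsProbabilityMeasure ν] (A : Set ℕ) :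
    HasSum (A.indicator fun k => ν.real {k}) (ν.real A) := by
  have h := Measure.tsum_indicator_apply_singleton ν A
    (DiscreteMeasurableSpace.forall_measurableSet A)
  have hne : ∑' k, A.indicator (fun k => ν {k}) k ≠ ⊤ := h ▸ measure_ne_top ν A
  have h2 := ENNReal.hasSum_toReal hne
  rw [← ENNReal.tsum_toReal_eq fun k => ENNReal.ne_top_of_tsum_ne_top hne k, h] at h2
  refine h2.congr_fun fun k => ?_
  by_cases hk : k ∈ A <;> simp [hk, measureReal_def]

theorem poissonMeasure_massFunction {Λ : ℝ} (hΛ : 0 < Λ) :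
    (∀ k, 0 < (poissonMeasure Λ.toNNReal).real {k}) ∧
    (∀ k : ℕ, ((k : ℝ) + 1) * (poissonMeasure Λ.toNNReal).real {k + 1} =
      Λ * (poissonMeasure Λ.toNNReal).real {k}) ∧
    HasSum (fun k => (poissonMeasure Λ.toNNReal).real {k}) 1 := by
  refine ⟨fun k => poissonMeasure_real_singleton_pos k (Real.toNNReal_pos.2 hΛ), fun k => ?_, ?_⟩
  · rw [poissonMeasure_real_singleton, poissonMeasure_real_singleton,
      Real.coe_toNNReal _ hΛ.le, Nat.factorial_succ]
    push_cast
    have : (k.factorial : ℝ) ≠ 0 := by positivity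
    field_simp
    ring
  · simp_rw [poissonMeasure_real_singleton]
    exact hasSum_one_poissonMeasure _

end TranslatedPoisson

/-! ### Comparison of a Stein pair with the translated Poisson law -/

namespace IsSteinPair

variable {Ω : Type*} [MeasurableSpace Ω] {P : Measure Ω} {W : Ω → ℤ} {S : Ω → ℝ} {μ lam : ℝ}

theorem measureReal_map_eq (h : IsSteinPair P W S μ lam) (A : Set ℤ) :
    (P.map W).real A = ∫ ω, A.indicator (fun _ => (1 : ℝ)) (W ω) ∂P := by
  have hA : MeasurableSet A := DiscreteMeasurableSpace.forall_measurableSet A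
  rw [map_measureReal_apply h.measurable hA, ← integral_indicator_one (h.measurable hA)]
  rfl

variable [IsProbabilityMeasure P]

/-- Below `⌊μ - v⌋` the distance from the mean exceeds `v`, so Chebyshev gives `v / v ^ 2`. -/
theorem measureReal_lt_floor_le (h : IsSteinPair P W S μ lam) {v : ℝ}
    (hvd : variance (fun ω => (W ω : ℝ)) P = v) (hv : 0 < v) :
    P.real {ω | W ω < ⌊μ - v⌋} ≤ 1 / v := by
  have hc := meas_ge_le_variance_div_sq (h.memLp_comp (fun w => (w : ℝ)) 2) hv
  rw [hvd, h.integral_eq] at hc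
  have hsub : {ω | W ω < ⌊μ - v⌋} ⊆ {ω | v ≤ |(W ω : ℝ) - μ|} := fun ω hω => by
    have h1 : (W ω : ℝ) < ⌊μ - v⌋ := by exact_mod_cast hω
    have h2 := Int.floor_le (μ - v)
    rw [Set.mem_ofPred_eq, abs_sub_comm]
    exact le_trans (by linarith) (le_abs_self _)
  have h3 := (measure_mono hsub).trans hc
  have h4 : v / v ^ 2 = 1 / v := by field_simp
  rw [h4] at h3
  exact ENNReal.toReal_le_of_le_ofReal (by positivity) h3

/-- Both distances reduce to this estimate; they differ only in the bound `B` on the `L²` norm of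
the difference of `g` at `W`. -/
theorem abs_measureReal_sub_translatedPoisson_le (h : IsSteinPair P W S μ lam) {v : ℝ}
    (hvd : variance (fun ω => (W ω : ℝ)) P = v) (hv : 0 < v) (A : Set ℤ) (g : ℕ → ℝ) (B : ℝ)
    (hg0 : g 0 = 0)
    (hstein : ∀ k : ℕ, (v + Int.fract (μ - v)) * g (k + 1) - k * g k =
      A.indicator (fun _ => (1 : ℝ)) (k + ⌊μ - v⌋) - (translatedPoisson μ v).real A)
    (hdiff : ∀ k, |g (k + 1) - g k| ≤ 1 / v)
    (hB : √(∫ ω, (g (W ω + 1 - ⌊μ - v⌋).toNat - g (W ω - ⌊μ - v⌋).toNat) ^ 2 ∂P) ≤ B) :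
    |(P.map W).real A - (translatedPoisson μ v).real A| ≤ √(variance S P) * B / lam + 2 / v := by
  have hl := h.lam_pos
  set m := ⌊μ - v⌋ with hm
  set γ := Int.fract (μ - v) with hγ
  set T := (translatedPoisson μ v).real A with hT
  have hγ0 : 0 ≤ γ := Int.fract_nonneg _
  have hγ1 : γ ≤ 1 := (Int.fract_lt_one _).le
  have hmγ : (m : ℝ) + γ = μ - v := Int.floor_add_fract _
  have hT0 : 0 ≤ T := measureReal_nonneg
  have hT1 : T ≤ 1 := measureReal_le_one
  -- Truncation by `toNat` extends `g` by `g 0 = 0` to the left of `m`, so both `G` and its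
  -- difference vanish there and only `E` remains.
  set G : ℤ → ℝ := fun w => g (w - m).toNat with hG
  set D : ℤ → ℝ := fun w => G (w + 1) - G w with hD
  set E : ℤ → ℝ := fun w =>
    if w < m then A.indicator (fun _ => (1 : ℝ)) w - T else 0 with hE
  have hD1 : ∀ w, |D w| ≤ 1 / v := fun w => by
    rcases lt_or_ge w m with hw | hw
    · have e1 : (w - m).toNat = 0 := by omega
      have e2 : (w + 1 - m).toNat = 0 := by omega
      simp only [hD, hG, e1, e2, sub_self, abs_zero]
      positivity
    · have e2 : (w + 1 - m).toNat = (w - m).toNat + 1 := by omega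
      simp only [hD, hG, e2]
      exact hdiff _
  -- With `k = w - m` and `m + γ = μ - v`, the Stein operator `(v + γ) g (k + 1) - k g k` equals `(v
  -- + γ) D w - (w - μ) G w`.
  have hpt : ∀ w, A.indicator (fun _ => (1 : ℝ)) w - T =
      (v + γ) * D w - ((w : ℝ) - μ) * G w + E w := fun w => by
    rcases lt_or_ge w m with hw | hw
    · have e1 : (w - m).toNat = 0 := by omega
      have e2 : (w + 1 - m).toNat = 0 := by omega
      simp only [hD, hE, hG, e1, e2, hg0, if_pos hw]
      ring
    · have e2 : (w + 1 - m).toNat = (w - m).toNat + 1 := by omega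
      have e3 : (((w - m).toNat : ℕ) : ℤ) = w - m := by omega
      have e4 : (((w - m).toNat : ℕ) : ℝ) = (w : ℝ) - m := by exact_mod_cast e3
      have := hstein (w - m).toNat
      rw [e3, sub_add_cancel, e4] at this
      rw [← this]
      simp only [hD, hE, hG, e2, if_neg (not_lt.2 hw)]
      linear_combination (g (w - m).toNat) * hmγ
  have hiD := h.integrable_comp D
  have hiE := h.integrable_comp E
  have hiG : Integrable (fun ω => ((W ω : ℝ) - μ) * G (W ω)) P :=
    h.integrable_comp fun w => ((w : ℝ) - μ) * G w
  have hiA := h.integrable_comp (A.indicator fun _ => (1 : ℝ))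
  have hid := h.identity G
  have hSD := h.integrable_mul_comp D
  have hcs := abs_integral_centered_mul_le h.memLp (h.memLp_comp D 2)
  rw [h.integral_rate, hvd] at hcs
  have i1 : Integrable (fun ω => (v + γ) * D (W ω)) P := hiD.const_mul _
  have i2 : Integrable (fun ω => (v + γ) * D (W ω) - ((W ω : ℝ) - μ) * G (W ω)) P := i1.sub hiG
  have e0 : (P.map W).real A - T = (v + γ) * (∫ ω, D (W ω) ∂P) -
      (∫ ω, ((W ω : ℝ) - μ) * G (W ω) ∂P) + ∫ ω, E (W ω) ∂P := by
    rw [← integral_const_mul, ← integral_sub i1 hiG, ← integral_add i2 hiE, h.measureReal_map_eq]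
    simp_rw [← hpt]
    rw [integral_sub hiA (integrable_const _)]
    simp
  have e1 : ∫ ω, (S ω - lam * v) * D (W ω) ∂P =
      (∫ ω, S ω * D (W ω) ∂P) - lam * v * ∫ ω, D (W ω) ∂P := by
    rw [← integral_const_mul, ← integral_sub hSD (hiD.const_mul _)]
    congr 1
    ext ω
    ring
  -- The Stein identity replaces the drift term by `S * D / lam`. As `S` has mean `lam * v`, the
  -- part `v * D` is absorbed by centring `S` and only `γ * D` is left.
  have e2 : (P.map W).real A - T = γ * (∫ ω, D (W ω) ∂P) -
      (∫ ω, (S ω - lam * v) * D (W ω) ∂P) / lam + ∫ ω, E (W ω) ∂P := by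
    rw [e0, e1, ← hid]
    field_simp
    ring
  have b1 : |γ * ∫ ω, D (W ω) ∂P| ≤ 1 / v := by
    rw [abs_mul, abs_of_nonneg hγ0]
    have : |∫ ω, D (W ω) ∂P| ≤ 1 / v := by
      have := norm_integral_le_of_norm_le_const (μ := P) (C := 1 / v) (f := fun ω => D (W ω))
        (ae_of_all _ fun ω => hD1 _)
      simpa using this
    nlinarith [abs_nonneg (∫ ω, D (W ω) ∂P)]
  have b2 : |(∫ ω, (S ω - lam * v) * D (W ω) ∂P) / lam| ≤ √(variance S P) * B / lam := by
    rw [abs_div, abs_of_pos hl]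
    gcongr
    exact hcs.trans (mul_le_mul_of_nonneg_left hB (Real.sqrt_nonneg _))
  have b3 : |∫ ω, E (W ω) ∂P| ≤ 1 / v := by
    refine le_trans ?_ (h.measureReal_lt_floor_le hvd hv)
    have hms : MeasurableSet {ω | W ω < m} :=
      h.measurable (DiscreteMeasurableSpace.forall_measurableSet {w | w < m})
    rw [← integral_indicator_one hms]
    refine (abs_integral_le_integral_abs).trans
      (integral_mono hiE.abs ((integrable_const 1).indicator hms) fun ω => ?_)
    simp only [hE, Set.indicator, Set.mem_ofPred_eq]
    split_ifs <;> simp [abs_le] <;> constructor <;> linarith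
  have e3 : 2 / v = 1 / v + 1 / v := by ring
  rw [e2, e3]
  have := abs_add_le (γ * (∫ ω, D (W ω) ∂P) - (∫ ω, (S ω - lam * v) * D (W ω) ∂P) / lam)
    (∫ ω, E (W ω) ∂P)
  have := abs_sub (γ * (∫ ω, D (W ω) ∂P)) ((∫ ω, (S ω - lam * v) * D (W ω) ∂P) / lam)
  linarith

end IsSteinPair

namespace IsSteinPair

variable {Ω : Type*} [MeasurableSpace Ω] {P : Measure Ω} [IsProbabilityMeasure P]
  {W : Ω → ℤ} {S : Ω → ℝ} {μ lam : ℝ}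

theorem tvDistInt_le (h : IsSteinPair P W S μ lam) {v : ℝ}
    (hvd : variance (fun ω => (W ω : ℝ)) P = v) (hv : 0 < v) :
    tvDistInt (P.map W) (translatedPoisson μ v) ≤ √(variance S P) / (lam * v) + 2 / v := by
  have hl := h.lam_pos
  refine ciSup_le fun A => ?_
  have hΛv : v ≤ v + Int.fract (μ - v) := by linarith [Int.fract_nonneg (μ - v)]
  have hΛ : 0 < v + Int.fract (μ - v) := hv.trans_le hΛv
  obtain ⟨hp, hrec, hsum⟩ := poissonMeasure_massFunction hΛ
  set Λ := v + Int.fract (μ - v) with hΛd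
  set p : ℕ → ℝ := fun k => (poissonMeasure Λ.toNNReal).real {k} with hpd
  replace hp : ∀ k, 0 < p k := hp
  set A' : Set ℕ := {k : ℕ | (k : ℤ) + ⌊μ - v⌋ ∈ A} with hA'
  have h0 : ∀ i, 0 ≤ A'.indicator p i := fun i => Set.indicator_nonneg (fun i _ => (hp i).le) i
  have hle : ∀ i, A'.indicator p i ≤ p i :=
    fun i => Set.indicator_le_self' (fun i _ => (hp i).le) i
  have hdiff : ∀ k, |poissonSteinSolution p (A'.indicator p) Λ (k + 1) -
      poissonSteinSolution p (A'.indicator p) Λ k| ≤ 1 / v := fun k =>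
    (abs_poissonSteinSolution_diff_le hΛ hp hrec hsum h0 hle k).trans
      (one_div_le_one_div_of_le hv hΛv)
  have hB : √(∫ ω, (poissonSteinSolution p (A'.indicator p) Λ (W ω + 1 - ⌊μ - v⌋).toNat -
      poissonSteinSolution p (A'.indicator p) Λ (W ω - ⌊μ - v⌋).toNat) ^ 2 ∂P) ≤ 1 / v := by
    refine Real.sqrt_le_iff.2 ⟨by positivity, ?_⟩
    calc _ ≤ ∫ _, (1 / v) ^ 2 ∂P := by
          refine integral_mono (h.integrable_comp fun w =>
            (poissonSteinSolution p (A'.indicator p) Λ (w + 1 - ⌊μ - v⌋).toNat -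
            poissonSteinSolution p (A'.indicator p) Λ (w - ⌊μ - v⌋).toNat) ^ 2)
            (integrable_const _) fun ω => ?_
          refine sq_le_sq' ?_ ?_ <;> rcases lt_or_ge (W ω) ⌊μ - v⌋ with hw | hw
          all_goals first
            | rw [show (W ω + 1 - ⌊μ - v⌋).toNat = (W ω - ⌊μ - v⌋).toNat by omega, sub_self]
              first
              | positivity
              | exact neg_nonpos.2 (by positivity)
            | rw [show (W ω + 1 - ⌊μ - v⌋).toNat = (W ω - ⌊μ - v⌋).toNat + 1 by omega]
              first
              | exact (abs_le.1 (hdiff _)).1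
              | exact (abs_le.1 (hdiff _)).2
      _ = (1 / v) ^ 2 := by simp
  have := h.abs_measureReal_sub_translatedPoisson_le hvd hv A
    (poissonSteinSolution p (A'.indicator p) Λ) (1 / v) rfl (fun k => ?_) hdiff hB
  · refine this.trans_eq ?_
    field_simp
  · rw [poissonSteinSolution_equation hΛ hp hrec, translatedPoisson_real_apply,
      (hasSum_measureReal_singleton (poissonMeasure Λ.toNNReal) A').tsum_eq]
    congr 1
    have := (hp k).ne'
    by_cases hk : (k : ℤ) + ⌊μ - v⌋ ∈ A
    · simp [Set.indicator, hA', hk, this]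
    · simp [Set.indicator, hA', hk]

theorem pointProb_le_maxPointProb (h : IsSteinPair P W S μ lam) (k : ℤ) :
    (P.map W).real {k} ≤ maxPointProb (P.map W) := by
  have : IsProbabilityMeasure (P.map W) :=
    Measure.isProbabilityMeasure_map h.measurable.aemeasurable
  exact le_ciSup (f := fun k : ℤ => (P.map W).real {k})
    ⟨1, by rintro _ ⟨k, rfl⟩; exact measureReal_le_one⟩ k

/-- The expectation is the sum of the squared differences weighted by point probabilities of `W`,
each at most `maxPointProb`. -/
theorem integral_diff_sq_le (h : IsSteinPair P W S μ lam) (m : ℤ) (g : ℕ → ℝ) {C : ℝ}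
    (hC : ∀ N, ∑ k ∈ Finset.range N, (g (k + 1) - g k) ^ 2 ≤ C) :
    ∫ ω, (g (W ω + 1 - m).toNat - g (W ω - m).toNat) ^ 2 ∂P ≤ maxPointProb (P.map W) * C := by
  obtain ⟨M, hM⟩ := h.bounded
  have hq : 0 ≤ maxPointProb (P.map W) := measureReal_nonneg.trans (h.pointProb_le_maxPointProb 0)
  have hint : ∀ k : ℕ, Integrable (fun ω => (g (k + 1) - g k) ^ 2 *
      Set.indicator {(k : ℤ) + m} (fun _ => (1 : ℝ)) (W ω)) P := fun k =>
    (h.integrable_comp (Set.indicator {(k : ℤ) + m} fun _ => (1 : ℝ))).const_mul _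
  calc _ ≤ ∫ ω, ∑ k ∈ Finset.range ((M - m).toNat + 1), (g (k + 1) - g k) ^ 2 *
        Set.indicator {(k : ℤ) + m} (fun _ => (1 : ℝ)) (W ω) ∂P := by
        refine integral_mono
          (h.integrable_comp fun w => (g (w + 1 - m).toNat - g (w - m).toNat) ^ 2)
          (integrable_finsetSum _ fun k _ => hint k) fun ω => ?_
        have hnn : ∀ k ∈ Finset.range ((M - m).toNat + 1), 0 ≤ (g (k + 1) - g k) ^ 2 *
            Set.indicator {(k : ℤ) + m} (fun _ => (1 : ℝ)) (W ω) := fun k _ =>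
          mul_nonneg (sq_nonneg _) (Set.indicator_nonneg (fun _ _ => zero_le_one) _)
        dsimp only
        rcases lt_or_ge (W ω) m with hw | hw
        · rw [show (W ω + 1 - m).toNat = (W ω - m).toNat by omega, sub_self]
          simpa using Finset.sum_nonneg hnn
        · have hWM := (abs_le.1 (hM ω)).2
          refine le_trans (le_of_eq ?_) (Finset.single_le_sum hnn
            (Finset.mem_range.2 (by omega : (W ω - m).toNat < (M - m).toNat + 1)))
          rw [show (W ω + 1 - m).toNat = (W ω - m).toNat + 1 by omega, Set.indicator_of_mem,
            mul_one]
          rw [Set.mem_singleton_iff]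
          omega
    _ = ∑ k ∈ Finset.range ((M - m).toNat + 1), (g (k + 1) - g k) ^ 2 *
        (P.map W).real {(k : ℤ) + m} := by
        rw [integral_finsetSum _ fun k _ => hint k]
        simp_rw [integral_const_mul, h.measureReal_map_eq]
    _ ≤ ∑ k ∈ Finset.range ((M - m).toNat + 1), (g (k + 1) - g k) ^ 2 *
        maxPointProb (P.map W) := by
        gcongr
        exact h.pointProb_le_maxPointProb _
    _ ≤ _ := by
        rw [← Finset.sum_mul, mul_comm]
        exact mul_le_mul_of_nonneg_left (hC _) hq

theorem locDistInt_le (h : IsSteinPair P W S μ lam) {v : ℝ}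
    (hvd : variance (fun ω => (W ω : ℝ)) P = v) (hv : 0 < v) :
    locDistInt (P.map W) (translatedPoisson μ v) ≤
      2 * √(maxPointProb (P.map W) * variance S P) / (lam * v) + 2 / v := by
  have hl := h.lam_pos
  have hq : 0 ≤ maxPointProb (P.map W) := measureReal_nonneg.trans (h.pointProb_le_maxPointProb 0)
  refine ciSup_le fun a => ?_
  have hΛv : v ≤ v + Int.fract (μ - v) := by linarith [Int.fract_nonneg (μ - v)]
  have hΛ : 0 < v + Int.fract (μ - v) := hv.trans_le hΛv
  obtain ⟨hp, hrec, hsum⟩ := poissonMeasure_massFunction hΛ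
  rcases lt_or_ge a ⌊μ - v⌋ with ha | ha
  -- Left of its support the translated Poisson law has no mass, and Chebyshev alone suffices.
  · have e : (translatedPoisson μ v).real {a} = 0 := by
      rw [translatedPoisson_real_apply]
      have : {k : ℕ | (k : ℤ) + ⌊μ - v⌋ ∈ ({a} : Set ℤ)} = ∅ := by
        ext k
        simp only [Set.mem_ofPred_eq, Set.mem_singleton_iff, Set.mem_empty_iff_false, iff_false]
        omega
      rw [this, measureReal_empty]
    rw [e, sub_zero, abs_of_nonneg measureReal_nonneg,
      map_measureReal_apply h.measurable (measurableSet_singleton a)]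
    have h1 : P.real (W ⁻¹' {a}) ≤ P.real {ω | W ω < ⌊μ - v⌋} :=
      measureReal_mono fun ω hω => by
        have : W ω = a := hω
        simpa [this] using ha
    have h2 := h.measureReal_lt_floor_le hvd hv
    have h3 : 1 / v ≤ 2 / v := by gcongr; norm_num
    have h4 : 0 ≤ 2 * √(maxPointProb (P.map W) * variance S P) / (lam * v) := by positivity
    linarith
  set Λ := v + Int.fract (μ - v) with hΛd
  set p : ℕ → ℝ := fun k => (poissonMeasure Λ.toNNReal).real {k} with hpd
  replace hp : ∀ k, 0 < p k := hp
  obtain ⟨j, hj⟩ : ∃ j : ℕ, (j : ℤ) = a - ⌊μ - v⌋ := ⟨(a - ⌊μ - v⌋).toNat, by omega⟩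
  have h0 : ∀ i, 0 ≤ (Pi.single j (p j) : ℕ → ℝ) i := fun i => by
    by_cases hi : i = j
    · subst hi; simp [(hp i).le]
    · simp [Pi.single_eq_of_ne hi]
  have hle : ∀ i, (Pi.single j (p j) : ℕ → ℝ) i ≤ p i := fun i => by
    by_cases hi : i = j
    · subst hi; simp
    · simp [Pi.single_eq_of_ne hi, (hp i).le]
  have hC := sum_sq_poissonSteinSolution_diff_le hΛ hp hrec hsum j
  set g := poissonSteinSolution p (Pi.single j (p j)) Λ with hg
  have hB : √(∫ ω, (g (W ω + 1 - ⌊μ - v⌋).toNat - g (W ω - ⌊μ - v⌋).toNat) ^ 2 ∂P) ≤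
      2 * √(maxPointProb (P.map W)) / v := by
    refine Real.sqrt_le_iff.2 ⟨by positivity, ?_⟩
    refine (h.integral_diff_sq_le ⌊μ - v⌋ g hC).trans ?_
    -- The constant `√2` from the sum of squares is relaxed to `2`.
    rw [div_pow, mul_pow, Real.sq_sqrt hq, mul_div_assoc', mul_comm]
    gcongr
    norm_num
  have := h.abs_measureReal_sub_translatedPoisson_le hvd hv {a} g _ rfl (fun k => ?_)
    (fun k => (abs_poissonSteinSolution_diff_le hΛ hp hrec hsum h0 hle k).trans
      (one_div_le_one_div_of_le hv hΛv)) hB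
  · refine this.trans_eq ?_
    rw [Real.sqrt_mul hq]
    field_simp
  · have hset : {k : ℕ | (k : ℤ) + ⌊μ - v⌋ ∈ ({a} : Set ℤ)} = {j} := by
      ext k
      simp only [Set.mem_ofPred_eq, Set.mem_singleton_iff]
      omega
    rw [hg, poissonSteinSolution_equation hΛ hp hrec, translatedPoisson_real_apply, hset,
      tsum_eq_single j fun b hb => Pi.single_eq_of_ne hb _, Pi.single_eq_same]
    congr 1
    by_cases hk : k = j
    · subst hk
      have : (k : ℤ) + ⌊μ - v⌋ = a := by omega
      simp [this, (hp k).ne']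
    · have : (k : ℤ) + ⌊μ - v⌋ ≠ a := by omega
      simp [this, Pi.single_eq_of_ne hk]

end IsSteinPair

/-! ### From equal marginals and unit steps to exchangeability and the Stein identity -/

section ExchangeablePair

variable {Ω : Type*} [MeasurableSpace Ω] {P : Measure Ω} {W W' : Ω → ℤ}

theorem integral_comp_swap (hW : Measurable W) (hW' : Measurable W')
    (hex : P.map (fun ω => (W ω, W' ω)) = P.map (fun ω => (W' ω, W ω))) (F : ℤ → ℤ → ℝ) :
    ∫ ω, F (W ω) (W' ω) ∂P = ∫ ω, F (W' ω) (W ω) ∂P := by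
  have h := congrArg (fun ν : Measure (ℤ × ℤ) => ∫ x, F x.1 x.2 ∂ν) hex
  rwa [integral_map (hW.prodMk hW').aemeasurable .of_discrete,
    integral_map (hW'.prodMk hW).aemeasurable .of_discrete] at h

variable [IsProbabilityMeasure P]

theorem integral_mul_comp_eq_integral_condExp_mul_comp (hW : Measurable W)
    {f : Ω → ℝ} (hf : Integrable f P) (g : ℤ → ℝ)
    (hfg : Integrable (fun ω => f ω * g (W ω)) P) :
    ∫ ω, f ω * g (W ω) ∂P = ∫ ω, (P[f | MeasurableSpace.comap W ⊤]) ω * g (W ω) ∂P := by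
  have hle : MeasurableSpace.comap W ⊤ ≤ ‹MeasurableSpace Ω› := hW.comap_le
  have hg : StronglyMeasurable[MeasurableSpace.comap W ⊤] fun ω => g (W ω) :=
    ((Measurable.of_discrete (f := g)).comp (comap_measurable W)).stronglyMeasurable
  have h := condExp_mul_of_stronglyMeasurable_right (μ := P) (f := f) hg hfg hf
  calc _ = ∫ ω, (P[f * (fun ω => g (W ω)) | MeasurableSpace.comap W ⊤]) ω ∂P :=
        (integral_condExp hle).symm
    _ = _ := integral_congr_ae h

/-- As `W ≤ a` and `W' ≤ a` are equally likely, so are `W ≤ a < W'` and `W' ≤ a < W`. With unit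
steps these are single transitions between `a` and `a + 1`, so the joint mass function is symmetric.
-/
theorem map_prodMk_comm_of_skipFree (hW : Measurable W) (hW' : Measurable W')
    (hlaw : P.map W' = P.map W)
    (hstep : ∀ᵐ ω ∂P, W' ω - W ω = -1 ∨ W' ω - W ω = 0 ∨ W' ω - W ω = 1) :
    P.map (fun ω => (W ω, W' ω)) = P.map (fun ω => (W' ω, W ω)) := by
  have hflux : ∀ a : ℤ, P.real {ω | W ω = a ∧ W' ω = a + 1} =
      P.real {ω | W ω = a + 1 ∧ W' ω = a} := fun a => by
    have hA : MeasurableSet {ω | W ω ≤ a} :=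
      hW (DiscreteMeasurableSpace.forall_measurableSet {w | w ≤ a})
    have hA' : MeasurableSet {ω | W' ω ≤ a} :=
      hW' (DiscreteMeasurableSpace.forall_measurableSet {w | w ≤ a})
    have e1 := measureReal_inter_add_sdiff (μ := P) (s := {ω | W ω ≤ a}) hA'
    have e2 := measureReal_inter_add_sdiff (μ := P) (s := {ω | W' ω ≤ a}) hA
    have e3 : P.real {ω | W' ω ≤ a} = P.real {ω | W ω ≤ a} := by
      have := congrArg (fun ν : Measure ℤ => ν.real {w | w ≤ a}) hlaw
      simp only [map_measureReal_apply hW (DiscreteMeasurableSpace.forall_measurableSet _),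
        map_measureReal_apply hW' (DiscreteMeasurableSpace.forall_measurableSet _)] at this
      exact this
    rw [Set.inter_comm] at e2
    have e4 : P.real {ω | W ω = a ∧ W' ω = a + 1} = P.real ({ω | W ω ≤ a} \ {ω | W' ω ≤ a}) := by
      refine measureReal_congr ?_
      filter_upwards [hstep] with ω hω
      refine propext (?_ : (W ω = a ∧ W' ω = a + 1) ↔ (W ω ≤ a ∧ ¬ W' ω ≤ a))
      omega
    have e5 : P.real {ω | W ω = a + 1 ∧ W' ω = a} = P.real ({ω | W' ω ≤ a} \ {ω | W ω ≤ a}) := by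
      refine measureReal_congr ?_
      filter_upwards [hstep] with ω hω
      refine propext (?_ : (W ω = a + 1 ∧ W' ω = a) ↔ (W' ω ≤ a ∧ ¬ W ω ≤ a))
      omega
    rw [e4, e5]
    linarith
  have hnull : ∀ a b : ℤ, b - a ≠ -1 → b - a ≠ 0 → b - a ≠ 1 →
      P.real {ω | W ω = a ∧ W' ω = b} = 0 := fun a b h1 h2 h3 => by
    rw [← measureReal_empty (μ := P)]
    refine measureReal_congr ?_
    filter_upwards [hstep] with ω hω
    refine propext (?_ : (W ω = a ∧ W' ω = b) ↔ False)
    rw [iff_false]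
    rintro ⟨rfl, rfl⟩
    tauto
  have hsymm : ∀ a b : ℤ, P.real {ω | W ω = a ∧ W' ω = b} =
      P.real {ω | W ω = b ∧ W' ω = a} := fun a b => by
    by_cases h0 : b - a = 0
    · obtain rfl : b = a := by omega
      rfl
    by_cases h1 : b - a = 1
    · obtain rfl : b = a + 1 := by omega
      exact hflux a
    by_cases h2 : b - a = -1
    · obtain rfl : a = b + 1 := by omega
      exact (hflux b).symm
    rw [hnull a b h2 h0 h1, hnull b a (by omega) (by omega) (by omega)]
  refine Measure.ext_of_singleton fun x => ?_
  have : IsProbabilityMeasure (P.map fun ω => (W ω, W' ω)) :=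
    Measure.isProbabilityMeasure_map (hW.prodMk hW').aemeasurable
  have : IsProbabilityMeasure (P.map fun ω => (W' ω, W ω)) :=
    Measure.isProbabilityMeasure_map (hW'.prodMk hW).aemeasurable
  rw [← measureReal_eq_measureReal_iff,
    map_measureReal_apply (hW.prodMk hW') (measurableSet_singleton x),
    map_measureReal_apply (hW'.prodMk hW) (measurableSet_singleton x)]
  obtain ⟨a, b⟩ := x
  have e1 : (fun ω => (W ω, W' ω)) ⁻¹' {(a, b)} = {ω | W ω = a ∧ W' ω = b} := by
    ext ω; simp
  have e2 : (fun ω => (W' ω, W ω)) ⁻¹' {(a, b)} = {ω | W ω = b ∧ W' ω = a} := by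
    ext ω; simp [and_comm]
  rw [e1, e2, hsymm]

/-- The regression turns `lam * 𝔼[(W - μ) g(W)]` into `𝔼[(W - W') g(W)]`. By exchangeability this is
half of `𝔼[(W' - W) (g(W') - g(W))]`, to which up-steps and down-steps contribute equally. -/
theorem isSteinPair_of_exchangeable (hW : Measurable W) (hW' : Measurable W') {M : ℤ}
    (hM : ∀ ω, |W ω| ≤ M) (hM' : ∀ ω, |W' ω| ≤ M)
    (hex : P.map (fun ω => (W ω, W' ω)) = P.map (fun ω => (W' ω, W ω)))
    (hstep : ∀ᵐ ω ∂P, W' ω - W ω = -1 ∨ W' ω - W ω = 0 ∨ W' ω - W ω = 1)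
    {μ lam : ℝ} (hlam : 0 < lam)
    (hreg : P[fun ω => (W' ω : ℝ) - μ | MeasurableSpace.comap W ⊤] =ᵐ[P]
      fun ω => (1 - lam) * ((W ω : ℝ) - μ)) :
    IsSteinPair P W (P[Set.indicator {ω | W' ω = W ω + 1} (fun _ => (1 : ℝ)) |
      MeasurableSpace.comap W ⊤]) μ lam := by
  have hint : ∀ F : ℤ → ℤ → ℝ, Integrable (fun ω => F (W ω) (W' ω)) P := fun F =>
    memLp_one_iff_integrable.1 (memLp_comp_of_abs_le hW hW' hM hM' F 1)
  have hind : Set.indicator {ω | W' ω = W ω + 1} (fun _ => (1 : ℝ)) =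
      fun ω => if W' ω = W ω + 1 then 1 else 0 := by
    ext ω; simp [Set.indicator]
  rw [hind]
  refine ⟨hW, ⟨M, hM⟩, ?_, hlam, fun g => ?_⟩
  · exact (memLp_comp_of_abs_le hW hW' hM hM' (fun a b => if b = a + 1 then 1 else 0) 2).condExp
      one_le_two
  · rw [← integral_mul_comp_eq_integral_condExp_mul_comp (P := P) hW
      (hint fun a b => if b = a + 1 then 1 else 0) (fun w => g (w + 1) - g w)
      (hint fun a b => (if b = a + 1 then 1 else 0) * (g (a + 1) - g a))]
    have h1 : ∫ ω, ((W' ω : ℝ) - μ) * g (W ω) ∂P =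
        (1 - lam) * ∫ ω, ((W ω : ℝ) - μ) * g (W ω) ∂P := by
      rw [integral_mul_comp_eq_integral_condExp_mul_comp hW (hint fun _ b => (b : ℝ) - μ) g
        (hint fun a b => ((b : ℝ) - μ) * g a), ← integral_const_mul]
      refine integral_congr_ae ?_
      filter_upwards [hreg] with ω hω
      rw [hω]
      ring
    have h2 : ∫ ω, ((W ω : ℝ) - W' ω) * g (W ω) ∂P =
        (∫ ω, ((W ω : ℝ) - μ) * g (W ω) ∂P) - ∫ ω, ((W' ω : ℝ) - μ) * g (W ω) ∂P := by
      rw [← integral_sub (hint fun a _ => ((a : ℝ) - μ) * g a)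
        (hint fun a b => ((b : ℝ) - μ) * g a)]
      congr 1
      ext ω
      ring
    have h3 : ∫ ω, ((W ω : ℝ) - W' ω) * g (W ω) ∂P =
        ∫ ω, ((W' ω : ℝ) - W ω) * g (W' ω) ∂P :=
      integral_comp_swap hW hW' hex fun a b => ((a : ℝ) - b) * g a
    have h4 : ∫ ω, (if W' ω = W ω + 1 then (1 : ℝ) else 0) * (g (W ω + 1) - g (W ω)) ∂P =
        ∫ ω, (if W ω = W' ω + 1 then (1 : ℝ) else 0) * (g (W' ω + 1) - g (W' ω)) ∂P :=
      integral_comp_swap hW hW' hex fun a b => (if b = a + 1 then 1 else 0) * (g (a + 1) - g a)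
    have h5 : (∫ ω, ((W ω : ℝ) - W' ω) * g (W ω) ∂P) +
        ∫ ω, ((W' ω : ℝ) - W ω) * g (W' ω) ∂P =
        (∫ ω, (if W' ω = W ω + 1 then (1 : ℝ) else 0) * (g (W ω + 1) - g (W ω)) ∂P) +
        ∫ ω, (if W ω = W' ω + 1 then (1 : ℝ) else 0) * (g (W' ω + 1) - g (W' ω)) ∂P := by
      rw [← integral_add (hint fun a b => ((a : ℝ) - b) * g a)
          (hint fun a b => ((b : ℝ) - a) * g b),
        ← integral_add (hint fun a b => (if b = a + 1 then 1 else 0) * (g (a + 1) - g a))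
          (hint fun a b => (if a = b + 1 then 1 else 0) * (g (b + 1) - g b))]
      refine integral_congr_ae ?_
      filter_upwards [hstep] with ω hω
      rcases hω with hω | hω | hω
      · have e : W ω = W' ω + 1 := by omega
        have e' : W' ω ≠ W' ω + 1 + 1 := by omega
        simp only [e, e', if_true, if_false]
        push_cast
        ring
      · have e : W ω = W' ω := by omega
        simp [e]
      · have e : W' ω = W ω + 1 := by omega
        have e' : W ω ≠ W ω + 1 + 1 := by omega
        simp only [e, e', if_true, if_false]
        push_cast
        ring
    linarith

end ExchangeablePair

/-! ### Positivity of invariant signed measures -/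

section InvariantSignedMeasure

variable {X : Type*} [Fintype X]

/-- The set where an invariant signed measure of a finite Markov chain is positive is closed under
the transitions of the chain. -/
theorem pos_of_invariant_of_pos {K : X → X → ℝ} (hK : ∀ x y, 0 ≤ K x y) (hK1 : ∀ x, ∑ y, K x y = 1)
    {ν : X → ℝ} (hν : ∀ y, ∑ x, ν x * K x y = ν y) {x y : X} (hx : 0 < ν x) (hxy : 0 < K x y) :
    0 < ν y := by
  -- The positive part satisfies `ν⁺ ≤ ν⁺ K` pointwise. Both sides have the same total mass, so they
  -- are equal, and positivity at `x` is passed on to `y`.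
  have hle : ∀ z ∈ Finset.univ, max (ν z) 0 ≤ ∑ w, max (ν w) 0 * K w z := fun z _ => by
    refine max_le ?_ (Finset.sum_nonneg fun w _ => mul_nonneg (le_max_right _ _) (hK w z))
    rw [← hν z]
    exact Finset.sum_le_sum fun w _ => mul_le_mul_of_nonneg_right (le_max_left _ _) (hK w z)
  have hsum : ∑ z, max (ν z) 0 = ∑ z, ∑ w, max (ν w) 0 * K w z := by
    rw [Finset.sum_comm]
    simp_rw [← Finset.mul_sum, hK1, mul_one]
  have heq := (Finset.sum_eq_sum_iff_of_le hle).1 hsum y (Finset.mem_univ y)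
  have h1 : max (ν x) 0 * K x y ≤ ∑ w, max (ν w) 0 * K w y :=
    Finset.single_le_sum (f := fun w => max (ν w) 0 * K w y)
      (fun w _ => mul_nonneg (le_max_right _ _) (hK w y)) (Finset.mem_univ x)
  have h2 : 0 < max (ν x) 0 * K x y := mul_pos (lt_max_of_lt_left hx) hxy
  rw [← heq] at h1
  by_contra hy
  rw [max_eq_right (not_lt.1 hy)] at h1
  linarith

end InvariantSignedMeasure

/-! ### Components with and without odd closed walks -/

section OddClosedWalk

variable {V : Type*} {G : SimpleGraph V}

variable (G) in
/-- The vertex lies on a closed walk of odd length. -/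
def OnOddClosedWalk (v : V) : Prop := ∃ p : G.Walk v v, Odd p.length

/-- Going along the edge and back adds two to the length, so the property is constant on connected
components. -/
theorem OnOddClosedWalk.of_adj {u v : V} (h : G.Adj u v) (hu : OnOddClosedWalk G u) :
    OnOddClosedWalk G v := by
  obtain ⟨p, hp⟩ := hu
  refine ⟨.cons h.symm (p.concat h), ?_⟩
  rw [SimpleGraph.Walk.length_cons, SimpleGraph.Walk.length_concat]
  exact hp.add_even even_two

theorem onOddClosedWalk_iff_of_adj {u v : V} (h : G.Adj u v) :
    OnOddClosedWalk G u ↔ OnOddClosedWalk G v :=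
  ⟨.of_adj h, .of_adj h.symm⟩

open Classical in
variable (G) in
/-- Reverse the opinions of all vertices that lie on a closed walk of odd length. -/
def flipOdd (x : V → Bool) (v : V) : Bool :=
  if OnOddClosedWalk G v then !x v else x v

theorem flipOdd_involutive : Function.Involutive (flipOdd G) := fun x => by
  ext v
  by_cases h : OnOddClosedWalk G v <;> simp [flipOdd, h]

variable (G) in
-- Deleting the edges of the components with odd closed walks leaves a graph without odd closed
-- walks, hence two-colourable.
theorem exists_sign_alternating_off_odd : ∃ c : V → ℝ, (∀ v, c v = 1 ∨ c v = -1) ∧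
    ∀ i j, G.Adj i j → ¬ OnOddClosedWalk G i → c i = -c j := by
  let H : SimpleGraph V :=
    { Adj := fun a b => G.Adj a b ∧ ¬ OnOddClosedWalk G a
      symm := ⟨fun a b h => ⟨h.1.symm, mt (onOddClosedWalk_iff_of_adj h.1).2 h.2⟩⟩
      loopless := ⟨fun a h => G.loopless.irrefl a h.1⟩ }
  have hle : H ≤ G := fun a b h => h.1
  have hH : H.Colorable 2 := by
    rw [SimpleGraph.two_colorable_iff_forall_loop_even]
    intro u w
    by_contra hw
    rw [Nat.not_even_iff_odd] at hw
    have hG : OnOddClosedWalk G u := ⟨w.mapLe hle, by simpa using hw⟩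
    cases w with
    | nil => simp at hw
    | cons h p => exact h.2 hG
  obtain ⟨C⟩ := hH
  refine ⟨fun v => if C v = 0 then 1 else -1, fun v => ?_, fun i j hij hi => ?_⟩
  · by_cases h : C v = 0 <;> simp [h]
  · have hne : C i ≠ C j := C.valid (show H.Adj i j from ⟨hij, hi⟩)
    by_cases h1 : C i = 0 <;> by_cases h2 : C j = 0
    · exact absurd (h1.trans h2.symm) hne
    · simp [h1, h2]
    · simp [h1, h2]
    · exact absurd (Fin.ext (by omega)) hne

end OddClosedWalk

/-! ### Reachability of states -/

section AntiVoterDynamics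

variable {V : Type*} [DecidableEq V] (G : SimpleGraph V)

/-- `AntiVoterStep G x y`: the state `y` arises from `x` by giving a vertex the opinion opposite to
that of one of its neighbours. -/
def AntiVoterStep (x y : V → Bool) : Prop :=
  ∃ i j, G.Adj i j ∧ y = Function.update x i (!x j)

variable {G}

/-- Starting from `x`, update the vertices along a walk one after the other, each from its
predecessor on the walk. -/
def followWalk : ∀ {u v : V}, G.Walk u v → (V → Bool) → V → Bool
  | _, _, .nil, x => x
  | u, _, .cons (v := w) _ p, x => followWalk p (Function.update x w (!x u))

theorem reflTransGen_followWalk {u v : V} (p : G.Walk u v) (x : V → Bool) :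
    Relation.ReflTransGen (AntiVoterStep G) x (followWalk p x) := by
  induction p generalizing x with
  | nil => exact .refl
  | @cons u w v h p ih => exact .head ⟨w, u, h.symm, rfl⟩ (ih _)

theorem followWalk_of_notMem {u v : V} (p : G.Walk u v) (x : V → Bool) {a : V}
    (ha : a ∉ p.support) : followWalk p x a = x a := by
  induction p generalizing x with
  | nil => rfl
  | @cons u w v h p ih =>
    rw [SimpleGraph.Walk.support_cons, List.mem_cons, not_or] at ha
    have haw : a ≠ w := fun e => ha.2 (e ▸ p.start_mem_support)
    rw [followWalk, ih _ ha.2, Function.update_of_ne haw]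

/-- Every vertex of the walk is rewritten from its predecessor, so the final opinions on the walk
depend only on the opinion at its start. -/
theorem followWalk_congr {u v : V} (p : G.Walk u v) {x y : V → Bool} (hxy : x u = y u) {a : V}
    (ha : a ∈ p.support) : followWalk p x a = followWalk p y a := by
  induction p generalizing x y with
  | nil =>
    rw [SimpleGraph.Walk.support_nil, List.mem_singleton] at ha
    subst ha
    exact hxy
  | @cons u w v h p ih =>
    rw [followWalk, followWalk]
    by_cases hap : a ∈ p.support
    · exact ih (by simp [hxy]) hap
    · rw [SimpleGraph.Walk.support_cons, List.mem_cons] at ha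
      obtain rfl := ha.resolve_right hap
      rw [followWalk_of_notMem p _ hap, followWalk_of_notMem p _ hap,
        Function.update_of_ne h.ne, Function.update_of_ne h.ne, hxy]

theorem followWalk_end {u v : V} (p : G.Walk u v) (x : V → Bool) :
    followWalk p x v = if Even p.length then x u else !x u := by
  induction p generalizing x with
  | nil => simp [followWalk]
  | @cons u w v h p ih =>
    rw [followWalk, ih, SimpleGraph.Walk.length_cons]
    by_cases he : Even p.length <;> simp [he, Nat.even_add_one]

/-- Let `x` and `y` differ at `v`, and take an odd closed walk at `v`. Following it once from `x`
reverses the opinion at `v`, which then equals `y v`. A second pass from there and a single pass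
from `y` agree on the whole walk and change nothing off it, so the number of disagreements drops. -/
theorem exists_common_reachable [Fintype V] (x y : V → Bool)
    (hxy : ∀ v, ¬ OnOddClosedWalk G v → x v = y v) :
    ∃ z, Relation.ReflTransGen (AntiVoterStep G) x z ∧
      Relation.ReflTransGen (AntiVoterStep G) y z := by
  induction hn : (Finset.univ.filter fun v => x v ≠ y v).card using Nat.strong_induction_on
    generalizing x y with
  | _ n ih =>
    by_cases h : ∀ v, x v = y v
    · obtain rfl : x = y := funext h
      exact ⟨x, .refl, .refl⟩
    push Not at h
    obtain ⟨v, hv⟩ := h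
    obtain ⟨p, hp⟩ : OnOddClosedWalk G v := by
      by_contra hB
      exact hv (hxy v hB)
    have hend : followWalk p x v = y v := by
      rw [followWalk_end, if_neg (Nat.not_even_iff_odd.2 hp)]
      revert hv
      cases x v <;> cases y v <;> simp
    have hon : ∀ a ∈ p.support, followWalk p (followWalk p x) a = followWalk p y a :=
      fun a ha => followWalk_congr p hend ha
    have hoff : ∀ a ∉ p.support, followWalk p (followWalk p x) a = x a ∧ followWalk p y a = y a :=
      fun a ha => by
        rw [followWalk_of_notMem p _ ha, followWalk_of_notMem p _ ha, followWalk_of_notMem p _ ha]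
        exact ⟨rfl, rfl⟩
    have hlt : (Finset.univ.filter fun a => followWalk p (followWalk p x) a ≠
        followWalk p y a).card < n := by
      rw [← hn]
      refine Finset.card_lt_card (Finset.ssubset_iff_of_subset (fun a ha => ?_) |>.2 ⟨v, ?_, ?_⟩)
      · rw [Finset.mem_filter] at ha ⊢
        refine ⟨Finset.mem_univ a, fun e => ha.2 ?_⟩
        by_cases hs : a ∈ p.support
        · exact hon a hs
        · rw [(hoff a hs).1, (hoff a hs).2, e]
      · simpa using hv
      · simpa using hon v p.start_mem_support
    obtain ⟨z, h1, h2⟩ := ih _ hlt (followWalk p (followWalk p x)) (followWalk p y)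
      (fun a ha => by
        by_cases hs : a ∈ p.support
        · exact hon a hs
        · rw [(hoff a hs).1, (hoff a hs).2, hxy a ha]) rfl
    exact ⟨z, ((reflTransGen_followWalk p x).trans (reflTransGen_followWalk p _)).trans h1,
      (reflTransGen_followWalk p y).trans h2⟩

/-- Adjacent vertices are both reversed or both kept, so the reversal commutes with every anti-voter
update. -/
theorem flipOdd_update {i j : V} (h : G.Adj i j) (x : V → Bool) :
    flipOdd G (Function.update x i (!x j)) =
      Function.update (flipOdd G x) i (!flipOdd G x j) := by
  ext v
  by_cases hv : v = i
  · subst hv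
    by_cases hB : OnOddClosedWalk G v
    · simp [flipOdd, hB, (onOddClosedWalk_iff_of_adj h).1 hB]
    · simp [flipOdd, hB, mt (onOddClosedWalk_iff_of_adj h).2 hB]
  · simp [flipOdd, Function.update_of_ne hv]

end AntiVoterDynamics

/-! ### Spins, their sum and the neighbour products -/

section Spin

/-- The opinions `1` and `0` as the spins `1` and `-1`. -/
def spin (b : Bool) : ℝ := 2 * (b.toNat : ℝ) - 1

@[simp] theorem spin_not (b : Bool) : spin (!b) = -spin b := by
  cases b <;> norm_num [spin]

theorem spin_ne_zero (b : Bool) : spin b ≠ 0 := by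
  cases b <;> norm_num [spin]

variable {V : Type*} [Fintype V]

/-- The sum of all spins. -/
def totalSpin (x : V → Bool) : ℝ := ∑ i, spin (x i)

theorem oneCount_eq_totalSpin (x : V → Bool) :
    (oneCount x : ℝ) = (Fintype.card V + totalSpin x) / 2 := by
  simp only [oneCount, totalSpin, spin, Finset.sum_sub_distrib, ← Finset.mul_sum]
  push_cast
  simp

theorem oneCount_update [DecidableEq V] (x : V → Bool) (i : V) (b : Bool) :
    oneCount (Function.update x i b) = oneCount x + (b.toNat - (x i).toNat : ℤ) := by
  simp only [oneCount]
  rw [← Finset.add_sum_erase _ _ (Finset.mem_univ i),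
    ← Finset.add_sum_erase _ (fun i => ((x i).toNat : ℤ)) (Finset.mem_univ i)]
  rw [Finset.sum_congr rfl fun j hj => by
    rw [Function.update_of_ne (Finset.ne_of_mem_erase hj)], Function.update_self]
  ring

theorem sum_mul_spin_update [DecidableEq V] (c : V → ℝ) (x : V → Bool) (i : V) (b : Bool) :
    ∑ v, c v * spin (Function.update x i b v) =
      ∑ v, c v * spin (x v) + c i * (spin b - spin (x i)) := by
  rw [← Finset.add_sum_erase _ _ (Finset.mem_univ i),
    ← Finset.add_sum_erase _ (fun v => c v * spin (x v)) (Finset.mem_univ i)]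
  rw [Finset.sum_congr rfl fun j hj => by
    rw [Function.update_of_ne (Finset.ne_of_mem_erase hj)], Function.update_self]
  ring

theorem totalSpin_update [DecidableEq V] (x : V → Bool) (i : V) (b : Bool) :
    totalSpin (Function.update x i b) = totalSpin x + (spin b - spin (x i)) := by
  simpa [totalSpin] using sum_mul_spin_update (fun _ => 1) x i b

theorem abs_oneCount_le (x : V → Bool) : |oneCount x| ≤ Fintype.card V := by
  have h0 : 0 ≤ oneCount x := Finset.sum_nonneg fun i _ => Int.natCast_nonneg _
  rw [abs_of_nonneg h0]
  calc oneCount x ≤ ∑ _ : V, (1 : ℤ) := Finset.sum_le_sum fun i _ => by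
        exact_mod_cast Bool.toNat_le (x i)
    _ = _ := by simp

variable (G : SimpleGraph V) [DecidableRel G.Adj]

theorem neighbourProductSum_eq (x : V → Bool) :
    neighbourProductSum G x = ∑ i, ∑ j ∈ G.neighborFinset i, spin (x i) * spin (x j) := rfl

theorem sum_neighborFinset_comm (F : V → V → ℝ) :
    ∑ i, ∑ j ∈ G.neighborFinset i, F i j = ∑ i, ∑ j ∈ G.neighborFinset i, F j i := by
  have e : ∀ F : V → V → ℝ, ∑ i, ∑ j ∈ G.neighborFinset i, F i j =
      ∑ i, ∑ j, if G.Adj i j then F i j else 0 := fun F => by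
    refine Finset.sum_congr rfl fun i _ => ?_
    rw [← Finset.sum_filter]
    refine Finset.sum_congr ?_ fun _ _ => rfl
    ext j
    simp
  rw [e, e, Finset.sum_comm]
  simp_rw [G.adj_comm]

theorem neighbourProductSum_flipOdd (x : V → Bool) :
    neighbourProductSum G (flipOdd G x) = neighbourProductSum G x := by
  rw [neighbourProductSum_eq, neighbourProductSum_eq]
  refine Finset.sum_congr rfl fun i _ => Finset.sum_congr rfl fun j hj => ?_
  have h := onOddClosedWalk_iff_of_adj ((G.mem_neighborFinset i j).1 hj)
  by_cases hi : OnOddClosedWalk G i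
  · simp [flipOdd, hi, h.1 hi]
  · simp [flipOdd, hi, mt h.2 hi]

end Spin

/-! ### One-step averages of the anti-voter chain -/

section Transition

variable {V : Type*} [Fintype V] {G : SimpleGraph V} [DecidableRel G.Adj] {r : ℕ}

theorem sum_neighborFinset_const (hreg : G.IsRegularOfDegree r) (F : V → ℝ) :
    ∑ i, ∑ _j ∈ G.neighborFinset i, F i = r * ∑ i, F i := by
  rw [Finset.mul_sum]
  refine Finset.sum_congr rfl fun i _ => ?_
  rw [Finset.sum_const, SimpleGraph.card_neighborFinset_eq_degree, hreg.degree_eq, nsmul_eq_mul]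

theorem sum_neighborFinset_const' (hreg : G.IsRegularOfDegree r) (F : V → ℝ) :
    ∑ i, ∑ j ∈ G.neighborFinset i, F j = r * ∑ i, F i := by
  rw [sum_neighborFinset_comm G fun _ j => F j, sum_neighborFinset_const hreg]

variable [DecidableEq V]

theorem antiVoterTransition_eq (hreg : G.IsRegularOfDegree r) (x y : V → Bool) :
    antiVoterTransition G x y = 1 / ((Fintype.card V : ℝ) * r) *
      ∑ i, ∑ j ∈ G.neighborFinset i, if Function.update x i (!x j) = y then (1 : ℝ) else 0 := by
  simp only [antiVoterTransition, hreg.degree_eq]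
  rw [← Finset.mul_sum, ← mul_assoc, one_div_mul_one_div]

theorem sum_antiVoterTransition_mul (hreg : G.IsRegularOfDegree r) (x : V → Bool)
    (f : (V → Bool) → ℝ) :
    ∑ y, antiVoterTransition G x y * f y = 1 / ((Fintype.card V : ℝ) * r) *
      ∑ i, ∑ j ∈ G.neighborFinset i, f (Function.update x i (!x j)) := by
  simp_rw [antiVoterTransition_eq hreg, mul_assoc, Finset.sum_mul]
  rw [← Finset.mul_sum, Finset.sum_comm]
  congr 1
  refine Finset.sum_congr rfl fun i _ => ?_
  rw [Finset.sum_comm]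
  refine Finset.sum_congr rfl fun j _ => ?_
  simp

theorem antiVoterTransition_nonneg (x y : V → Bool) : 0 ≤ antiVoterTransition G x y := by
  unfold antiVoterTransition
  refine mul_nonneg (by positivity) (Finset.sum_nonneg fun i _ => mul_nonneg (by positivity)
    (Finset.sum_nonneg fun j _ => ?_))
  split_ifs <;> norm_num

theorem sum_antiVoterTransition [Nonempty V] (hreg : G.IsRegularOfDegree r) (hr : 0 < r)
    (x : V → Bool) : ∑ y, antiVoterTransition G x y = 1 := by
  have h := sum_antiVoterTransition_mul hreg x fun _ => 1
  simp only [mul_one] at h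
  rw [h, sum_neighborFinset_const hreg fun _ => 1]
  have : (Fintype.card V : ℝ) ≠ 0 := by exact_mod_cast Fintype.card_ne_zero
  have : (r : ℝ) ≠ 0 := by exact_mod_cast hr.ne'
  simp
  field_simp

theorem antiVoterTransition_pos_of_step {x y : V → Bool}
    (h : AntiVoterStep G x y) : 0 < antiVoterTransition G x y := by
  obtain ⟨i, j, hij, rfl⟩ := h
  have hV : 0 < Fintype.card V := Fintype.card_pos_iff.2 ⟨i⟩
  have hd : 0 < G.degree i := (G.degree_pos_iff_exists_adj i).2 ⟨j, hij⟩
  have hnn : ∀ a, ∀ b ∈ G.neighborFinset a,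
      (0 : ℝ) ≤ if Function.update x a (!x b) = Function.update x i (!x j) then 1 else 0 :=
    fun a b _ => by split_ifs <;> norm_num
  unfold antiVoterTransition
  refine mul_pos (by positivity) (Finset.sum_pos' (fun a _ => mul_nonneg (by positivity)
    (Finset.sum_nonneg (hnn a))) ⟨i, Finset.mem_univ i, mul_pos (by positivity) ?_⟩)
  exact Finset.sum_pos' (hnn i) ⟨j, (G.mem_neighborFinset i j).2 hij, by simp⟩

theorem antiVoterStep_of_transition_ne_zero {x y : V → Bool}
    (h : antiVoterTransition G x y ≠ 0) : AntiVoterStep G x y := by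
  by_contra hn
  refine h ?_
  unfold antiVoterTransition
  rw [Finset.sum_eq_zero, mul_zero]
  intro i _
  rw [Finset.sum_eq_zero, mul_zero]
  intro j hj
  rw [if_neg]
  rintro rfl
  exact hn ⟨i, j, (G.mem_neighborFinset i j).1 hj, rfl⟩

theorem antiVoterTransition_flipOdd (x y : V → Bool) :
    antiVoterTransition G (flipOdd G x) (flipOdd G y) = antiVoterTransition G x y := by
  unfold antiVoterTransition
  congr 1
  refine Finset.sum_congr rfl fun i _ => ?_
  congr 1
  refine Finset.sum_congr rfl fun j hj => ?_
  simp only [← flipOdd_update ((G.mem_neighborFinset i j).1 hj),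
    flipOdd_involutive.injective.eq_iff]

/-- An update removes the spin of `i` and adds minus the spin of `j`. By regularity `j` is uniform
as well, so each effect costs `totalSpin x / n` on average; this is the source of `λ = 2 / n`. -/
theorem sum_antiVoterTransition_mul_totalSpin [Nonempty V] (hreg : G.IsRegularOfDegree r)
    (hr : 0 < r) (x : V → Bool) :
    ∑ y, antiVoterTransition G x y * totalSpin y =
      (1 - 2 / (Fintype.card V : ℝ)) * totalSpin x := by
  have h0 : (Fintype.card V : ℝ) ≠ 0 := by exact_mod_cast Fintype.card_ne_zero
  have h1 : (r : ℝ) ≠ 0 := by exact_mod_cast hr.ne'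
  rw [sum_antiVoterTransition_mul hreg]
  simp_rw [totalSpin_update, spin_not, Finset.sum_add_distrib, Finset.sum_sub_distrib,
    Finset.sum_neg_distrib]
  rw [sum_neighborFinset_const hreg fun _ => totalSpin x,
    sum_neighborFinset_const hreg fun i => spin (x i),
    sum_neighborFinset_const' hreg fun i => spin (x i), Finset.sum_const, Finset.card_univ,
    nsmul_eq_mul, ← totalSpin]
  field_simp
  ring

theorem sum_antiVoterTransition_mul_up [Nonempty V] (hreg : G.IsRegularOfDegree r)
    (hr : 0 < r) (x : V → Bool) :
    ∑ y, antiVoterTransition G x y * (if oneCount y = oneCount x + 1 then 1 else 0) =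
      1 / 4 - totalSpin x / (2 * Fintype.card V) +
        neighbourProductSum G x / (4 * Fintype.card V * r) := by
  have h0 : (Fintype.card V : ℝ) ≠ 0 := by exact_mod_cast Fintype.card_ne_zero
  have h1 : (r : ℝ) ≠ 0 := by exact_mod_cast hr.ne'
  rw [sum_antiVoterTransition_mul hreg]
  -- The count rises exactly when both opinions are `0`, an event with indicator `(1 - spin (x i)) *
  -- (1 - spin (x j)) / 4`.
  have e : ∀ i j, (if oneCount (Function.update x i (!x j)) = oneCount x + 1 then (1 : ℝ) else 0) =
      1 / 4 - 1 / 4 * spin (x i) - 1 / 4 * spin (x j) + 1 / 4 * (spin (x i) * spin (x j)) :=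
    fun i j => by
      rw [oneCount_update]
      cases x i <;> cases x j <;> norm_num [spin]
  have hQ : ∑ i, ∑ j ∈ G.neighborFinset i, 1 / 4 * (spin (x i) * spin (x j)) =
      1 / 4 * neighbourProductSum G x := by
    simp_rw [neighbourProductSum_eq, Finset.mul_sum]
  simp_rw [e, Finset.sum_add_distrib, Finset.sum_sub_distrib]
  rw [hQ]
  simp_rw [← Finset.mul_sum]
  rw [sum_neighborFinset_const hreg fun _ => 1 / 4,
    sum_neighborFinset_const hreg fun i => spin (x i),
    sum_neighborFinset_const' hreg fun i => spin (x i), Finset.sum_const, Finset.card_univ,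
    nsmul_eq_mul, ← totalSpin]
  field_simp
  ring

end Transition

/-! ### Equilibrium laws: symmetry, alternation, decorrelation, nondegeneracy -/

section Stationary

variable {V : Type*} [Fintype V] [DecidableEq V] {G : SimpleGraph V}
  [DecidableRel G.Adj] {r : ℕ} {π : (V → Bool) → ℝ}

theorem sum_stationary_mul_transition
    (hπ : ∀ y, ∑ x, π x * antiVoterTransition G x y = π y) (f : (V → Bool) → ℝ) :
    ∑ x, π x * ∑ y, antiVoterTransition G x y * f y = ∑ x, π x * f x := by
  simp_rw [Finset.mul_sum]
  rw [Finset.sum_comm]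
  refine Finset.sum_congr rfl fun y _ => ?_
  rw [← hπ y, Finset.sum_mul]
  exact Finset.sum_congr rfl fun x _ => by ring

variable [Nonempty V]

theorem pos_of_reachable (hreg : G.IsRegularOfDegree r) (hr : 0 < r)
    (hπ : ∀ y, ∑ x, π x * antiVoterTransition G x y = π y) {x y : V → Bool} (hx : 0 < π x)
    (hxy : Relation.ReflTransGen (AntiVoterStep G) x y) : 0 < π y := by
  induction hxy with
  | refl => exact hx
  | tail _ h ih =>
    exact pos_of_invariant_of_pos (K := antiVoterTransition G) antiVoterTransition_nonneg
      (sum_antiVoterTransition hreg hr) hπ ih (antiVoterTransition_pos_of_step h)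

/-- The difference of `π` and its reflection is an invariant signed measure with opposite signs at
`x` and `flipOdd G x`. Both signs propagate to a common reachable state, so the difference vanishes.
-/
theorem stationary_flipOdd (hreg : G.IsRegularOfDegree r) (hr : 0 < r)
    (hπ : ∀ y, ∑ x, π x * antiVoterTransition G x y = π y) (x : V → Bool) :
    π (flipOdd G x) = π x := by
  have hinv : ∀ y, ∑ x, π (flipOdd G x) * antiVoterTransition G x y = π (flipOdd G y) := fun y => by
    rw [← hπ (flipOdd G y), ← Equiv.sum_comp (flipOdd_involutive (G := G)).toPerm]
    refine Finset.sum_congr rfl fun x _ => ?_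
    rw [Function.Involutive.coe_toPerm, flipOdd_involutive, ← antiVoterTransition_flipOdd,
      flipOdd_involutive]
  have key : ∀ x, π x ≤ π (flipOdd G x) := fun x => by
    by_contra! hx
    obtain ⟨z, h1, h2⟩ := exists_common_reachable (G := G) x (flipOdd G x)
      fun v hv => by simp [flipOdd, hv]
    have p1 := pos_of_reachable (π := fun x => π x - π (flipOdd G x)) hreg hr
      (fun y => by simp_rw [sub_mul, Finset.sum_sub_distrib, hπ, hinv]) (sub_pos.2 hx) h1
    have p2 := pos_of_reachable (π := fun x => π (flipOdd G x) - π x) hreg hr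
      (fun y => by simp_rw [sub_mul, Finset.sum_sub_distrib, hπ, hinv])
      (by simpa [flipOdd_involutive x] using hx) h2
    linarith
  refine le_antisymm ?_ (key x)
  simpa [flipOdd_involutive x] using key (flipOdd G x)

theorem sum_stationary_mul_totalSpin (hreg : G.IsRegularOfDegree r) (hr : 0 < r)
    (hπ : ∀ y, ∑ x, π x * antiVoterTransition G x y = π y) : ∑ x, π x * totalSpin x = 0 := by
  have h0 : (Fintype.card V : ℝ) ≠ 0 := by exact_mod_cast Fintype.card_ne_zero
  have h := sum_stationary_mul_transition hπ totalSpin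
  simp_rw [sum_antiVoterTransition_mul_totalSpin hreg hr, mul_left_comm (π _)] at h
  rw [← Finset.mul_sum] at h
  have h2 : 2 / (Fintype.card V : ℝ) * ∑ x, π x * totalSpin x = 0 := by linarith
  exact (mul_eq_zero.1 h2).resolve_left (by positivity)

open Classical in
-- The spin sum with alternating signs on the bipartite components, and weight zero elsewhere, is a
-- martingale. In equilibrium its second moment is constant, so its increments `-d i * (spin (x i) +
-- spin (x j))` vanish on the support.
theorem stationary_alternating_off_odd (hreg : G.IsRegularOfDegree r) (hr : 0 < r)
    (hπ0 : ∀ x, 0 ≤ π x) (hπ : ∀ y, ∑ x, π x * antiVoterTransition G x y = π y)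
    {x : V → Bool} (hx : 0 < π x) {i j : V} (hij : G.Adj i j) (hi : ¬ OnOddClosedWalk G i) :
    spin (x i) = -spin (x j) := by
  obtain ⟨c, hc1, hc⟩ := exists_sign_alternating_off_odd G
  set d : V → ℝ := fun v => if OnOddClosedWalk G v then 0 else c v with hd
  set f : (V → Bool) → ℝ := fun x => (∑ v, d v * spin (x v)) ^ 2 with hf
  have hdd : ∀ a b, G.Adj a b → d a = -d b := fun a b hab => by
    by_cases ha : OnOddClosedWalk G a
    · simp [hd, ha, (onOddClosedWalk_iff_of_adj hab).1 ha]
    · simp only [hd, if_neg ha, if_neg (mt (onOddClosedWalk_iff_of_adj hab).2 ha)]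
      exact hc a b hab ha
  have hn : (0 : ℝ) < Fintype.card V := by exact_mod_cast Fintype.card_pos
  have hr' : (0 : ℝ) < r := by exact_mod_cast hr
  have hstep : ∀ x, ∑ y, antiVoterTransition G x y * f y = f x + 1 / ((Fintype.card V : ℝ) * r) *
      ∑ i, ∑ j ∈ G.neighborFinset i, (d i * (spin (x i) + spin (x j))) ^ 2 := fun x => by
    rw [sum_antiVoterTransition_mul hreg]
    have e : ∀ i, ∀ j ∈ G.neighborFinset i, f (Function.update x i (!x j)) =
        f x + 2 * (∑ v, d v * spin (x v)) * (d j * spin (x j)) -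
          2 * (∑ v, d v * spin (x v)) * (d i * spin (x i)) +
          (d i * (spin (x i) + spin (x j))) ^ 2 := fun i j hj => by
      have := hdd i j ((G.mem_neighborFinset i j).1 hj)
      simp only [hf, sum_mul_spin_update, spin_not]
      rw [show d j = -d i by linarith]
      ring
    rw [Finset.sum_congr rfl fun i _ => Finset.sum_congr rfl (e i)]
    simp_rw [Finset.sum_add_distrib, Finset.sum_sub_distrib, Finset.sum_add_distrib]
    rw [sum_neighborFinset_const hreg fun _ => f x,
      sum_neighborFinset_const' hreg fun j => 2 * (∑ v, d v * spin (x v)) * (d j * spin (x j)),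
      sum_neighborFinset_const hreg fun i => 2 * (∑ v, d v * spin (x v)) * (d i * spin (x i)),
      Finset.sum_const, Finset.card_univ, nsmul_eq_mul]
    field_simp
    ring
  have hz := sum_stationary_mul_transition hπ f
  simp_rw [hstep, mul_add, Finset.sum_add_distrib] at hz
  have hz2 : ∑ x, π x * (1 / ((Fintype.card V : ℝ) * r) *
      ∑ i, ∑ j ∈ G.neighborFinset i, (d i * (spin (x i) + spin (x j))) ^ 2) = 0 := by
    simp_rw [mul_add]
    linarith
  have hsq : ∀ x : V → Bool, ∀ i ∈ Finset.univ, 0 ≤ ∑ j ∈ G.neighborFinset i,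
      (d i * (spin (x i) + spin (x j))) ^ 2 :=
    fun x i _ => Finset.sum_nonneg fun j _ => sq_nonneg _
  have h1 := (Finset.sum_eq_zero_iff_of_nonneg fun x _ => mul_nonneg (hπ0 x)
    (mul_nonneg (by positivity) (Finset.sum_nonneg (hsq x)))).1 hz2 x (Finset.mem_univ x)
  have h2 := ((mul_eq_zero.1 h1).resolve_left hx.ne')
  have h3 := (mul_eq_zero.1 h2).resolve_left (by positivity)
  have h4 := (Finset.sum_eq_zero_iff_of_nonneg (hsq x)).1 h3 i (Finset.mem_univ i)
  have h5 := (Finset.sum_eq_zero_iff_of_nonneg fun j _ => sq_nonneg _).1 h4 j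
    ((G.mem_neighborFinset i j).2 hij)
  have h6 := (mul_eq_zero.1 (pow_eq_zero_iff (two_ne_zero)|>.1 h5)).resolve_left (by
    simp only [hd, if_neg hi]
    rcases hc1 i with h | h <;> rw [h] <;> norm_num)
  linarith

open Classical in
-- On the bipartite components spins alternate along edges. Counting over edges of a regular graph,
-- their sum equals its own negative, hence is zero, and only reversed spins contribute to the
-- total.
theorem stationary_totalSpin_flipOdd (hreg : G.IsRegularOfDegree r) (hr : 0 < r)
    (hπ0 : ∀ x, 0 ≤ π x) (hπ : ∀ y, ∑ x, π x * antiVoterTransition G x y = π y)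
    {x : V → Bool} (hx : 0 < π x) : totalSpin (flipOdd G x) = -totalSpin x := by
  set o : V → ℝ := fun v => if OnOddClosedWalk G v then 0 else spin (x v) with ho
  have hoo : ∀ i, ∀ j ∈ G.neighborFinset i, o i = -o j := fun i j hj => by
    have hij := (G.mem_neighborFinset i j).1 hj
    by_cases hi : OnOddClosedWalk G i
    · simp [ho, hi, (onOddClosedWalk_iff_of_adj hij).1 hi]
    · simp only [ho, if_neg hi, if_neg (mt (onOddClosedWalk_iff_of_adj hij).2 hi)]
      exact stationary_alternating_off_odd hreg hr hπ0 hπ hx hij hi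
  have hr' : (r : ℝ) ≠ 0 := by exact_mod_cast hr.ne'
  have h0 : ∑ i, o i = 0 := by
    have h1 := sum_neighborFinset_const hreg o
    rw [Finset.sum_congr rfl fun i _ => Finset.sum_congr rfl (hoo i)] at h1
    simp_rw [Finset.sum_neg_distrib] at h1
    rw [sum_neighborFinset_const' hreg o] at h1
    have : (r : ℝ) * ∑ i, o i = 0 := by linarith
    exact (mul_eq_zero.1 this).resolve_left hr'
  have h1 : totalSpin (flipOdd G x) + totalSpin x = 2 * ∑ i, o i := by
    rw [totalSpin, totalSpin, ← Finset.sum_add_distrib, Finset.mul_sum]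
    refine Finset.sum_congr rfl fun i _ => ?_
    by_cases hi : OnOddClosedWalk G i
    · simp [ho, flipOdd, hi]
    · simp [ho, flipOdd, hi]
      ring
  rw [h0] at h1
  linarith

theorem sum_stationary_mul_totalSpin_mul_neighbourProductSum (hreg : G.IsRegularOfDegree r)
    (hr : 0 < r) (hπ0 : ∀ x, 0 ≤ π x)
    (hπ : ∀ y, ∑ x, π x * antiVoterTransition G x y = π y) :
    ∑ x, π x * (totalSpin x * neighbourProductSum G x) = 0 := by
  have h : ∑ x, π x * (totalSpin x * neighbourProductSum G x) =
      ∑ x, -(π x * (totalSpin x * neighbourProductSum G x)) := by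
    conv_lhs => rw [← Equiv.sum_comp (flipOdd_involutive (G := G)).toPerm]
    refine Finset.sum_congr rfl fun x _ => ?_
    rw [Function.Involutive.coe_toPerm, stationary_flipOdd hreg hr hπ, neighbourProductSum_flipOdd]
    rcases (hπ0 x).eq_or_lt with hx | hx
    · simp [← hx]
    · rw [stationary_totalSpin_flipOdd hreg hr hπ0 hπ hx]
      ring
  rw [Finset.sum_neg_distrib] at h
  linarith

/-- If the total spin vanished on the support, no supported state could have an edge with equal
opinions, since updating along it stays in the support but changes the total by two. Such a state
would be a proper two-colouring. -/
theorem sum_stationary_mul_totalSpin_sq_pos (hreg : G.IsRegularOfDegree r) (hr : 0 < r)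
    (hbip : ¬ G.IsBipartite) (hπ0 : ∀ x, 0 ≤ π x) (hπ1 : ∑ x, π x = 1)
    (hπ : ∀ y, ∑ x, π x * antiVoterTransition G x y = π y) :
    0 < ∑ x, π x * totalSpin x ^ 2 := by
  have hnn : ∀ x ∈ Finset.univ, 0 ≤ π x * totalSpin x ^ 2 :=
    fun x _ => mul_nonneg (hπ0 x) (sq_nonneg _)
  refine (Finset.sum_nonneg hnn).lt_of_ne fun h0 => hbip ?_
  have hzero : ∀ x, 0 < π x → totalSpin x = 0 := fun x hx => by
    have := (Finset.sum_eq_zero_iff_of_nonneg hnn).1 h0.symm x (Finset.mem_univ x)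
    exact pow_eq_zero_iff two_ne_zero |>.1 ((mul_eq_zero.1 this).resolve_left hx.ne')
  obtain ⟨x, -, hx⟩ : ∃ x ∈ Finset.univ, 0 < π x := by
    by_contra! hcon
    have := Finset.sum_nonpos hcon
    linarith
  refine SimpleGraph.Coloring.colorable (α := Bool) ⟨x, fun {i j} hij e => ?_⟩ |>.mono (by simp)
  have hij : G.Adj i j := hij
  have h1 := hzero _ (pos_of_reachable hreg hr hπ hx (.single ⟨i, j, hij, rfl⟩))
  rw [totalSpin_update, hzero x hx, spin_not, e] at h1
  exact spin_ne_zero (x j) (by linarith)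

end Stationary

/-! ### From the explicit bounds to the rates -/

section Rates

theorem rpow_three_halves {x : ℝ} (hx : 0 ≤ x) : x ^ (3 / 2 : ℝ) = x * √x := by
  rw [Real.sqrt_eq_rpow, show (3 / 2 : ℝ) = 1 + 1 / 2 by norm_num,
    Real.rpow_add_of_nonneg hx (by norm_num) (by norm_num), Real.rpow_one]

theorem rpow_three_quarters {x : ℝ} (hx : 0 ≤ x) : x ^ (3 / 4 : ℝ) = √x * √(√x) := by
  rw [← rpow_three_halves (Real.sqrt_nonneg x), Real.sqrt_eq_rpow x, ← Real.rpow_mul hx]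
  norm_num

/-- Up to a constant, `t ↦ t ^ (3 / 2)` is subadditive; replace both summands by the larger one. -/
theorem add_mul_sqrt_add_le {s a : ℝ} (hs : 0 ≤ s) (ha : 0 ≤ a) :
    (s + a) * √(2 * (s + a)) ≤ 4 * (s * √s + a * √a) := by
  have key : ∀ x y : ℝ, 0 ≤ x → 0 ≤ y → y ≤ x →
      (x + y) * √(2 * (x + y)) ≤ 4 * (x * √x + y * √y) := fun x y hx hy hxy => by
    have h1 : √(2 * (x + y)) ≤ 2 * √x := by
      rw [show 2 * √x = √(4 * x) by
        rw [Real.sqrt_mul (by norm_num), show (4 : ℝ) = 2 ^ 2 by norm_num,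
          Real.sqrt_sq (by norm_num)]]
      exact Real.sqrt_le_sqrt (by linarith)
    calc _ ≤ (2 * x) * (2 * √x) := by gcongr; linarith
      _ ≤ _ := by nlinarith [mul_nonneg hy (Real.sqrt_nonneg y)]
  rcases le_total a s with h | h
  · exact key s a hs ha h
  · rw [add_comm s a, add_comm (s * √s)]
    exact key a s ha hs h

variable {n r v vS vQ d : ℝ}

theorem sqrt_variance_rate_le (hn : 0 < n) (hr : 0 < r) (hv : 0 < v) (hQ : 0 ≤ vQ)
    (hS : vS ≤ (16 * r ^ 2 * √v ^ 2 + vQ) / (16 * r ^ 2 * n ^ 2)) :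
    √vS ≤ (√v + √vQ / r / 4) / n := by
  have hq := Real.sq_sqrt hQ
  have hs := Real.sqrt_nonneg v
  have hq0 := Real.sqrt_nonneg vQ
  refine Real.sqrt_le_iff.2 ⟨by positivity, hS.trans ?_⟩
  rw [div_le_iff₀ (by positivity)]
  have e : ((√v + √vQ / r / 4) / n) ^ 2 * (16 * r ^ 2 * n ^ 2) = (4 * r * √v + √vQ) ^ 2 := by
    field_simp
    ring
  rw [e]
  nlinarith [mul_nonneg (mul_nonneg hr.le hs) hq0]

theorem sqrt_variance_div_le (hn : 0 < n) (hr : 0 < r) (hv : 0 < v) (hQ : 0 ≤ vQ)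
    (hS : vS ≤ (16 * r ^ 2 * √v ^ 2 + vQ) / (16 * r ^ 2 * n ^ 2)) :
    √vS / (2 / n * √v ^ 2) ≤ 1 / √v + √vQ / (r * √v ^ 2) := by
  have hs := Real.sqrt_pos.2 hv
  have hq0 := Real.sqrt_nonneg vQ
  calc _ ≤ ((√v + √vQ / r / 4) / n) / (2 / n * √v ^ 2) := by
        gcongr
        exact sqrt_variance_rate_le hn hr hv hQ hS
    _ = 1 / 2 * (1 / √v) + 1 / 8 * (√vQ / (r * √v ^ 2)) := by
        field_simp
        ring
    _ ≤ _ := by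
        have h1 : 0 ≤ 1 / √v := by positivity
        have h2 : 0 ≤ √vQ / (r * √v ^ 2) := by positivity
        linarith

theorem tv_rate_of_bound (hn : 0 < n) (hr : 0 < r) (hv : 0 < v) (hQ : 0 ≤ vQ)
    (hS : vS ≤ (16 * r ^ 2 * √v ^ 2 + vQ) / (16 * r ^ 2 * n ^ 2)) (hd1 : d ≤ 1)
    (hd : d ≤ √vS / (2 / n * √v ^ 2) + 2 / √v ^ 2) :
    d ≤ 6 * (√vQ / (r * √v ^ 2) + 1 / √v) := by
  have hs := Real.sqrt_pos.2 hv
  have hb := sqrt_variance_div_le hn hr hv hQ hS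
  have h1 : 0 < 1 / √v := by positivity
  have h2 : 0 ≤ √vQ / (r * √v ^ 2) := by positivity
  -- For `σ ≥ 1` the term `2 / σ²` is absorbed into `2 / σ`; otherwise the right-hand side is at
  -- least `1`.
  rcases le_total 1 (√v) with h | h
  · have h3 : 2 / √v ^ 2 ≤ 2 * (1 / √v) := by
      rw [mul_one_div]
      gcongr
      nlinarith
    linarith
  · have h3 : 1 ≤ 1 / √v := by rwa [le_div_iff₀ hs, one_mul]
    linarith

/-- With `a = √vQ / r`, both `n * √vS` and `q * σ² / 2` are at most `σ + a`. The main term is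
therefore of order `(σ + a) ^ (3 / 2) / σ ^ 3`. -/
theorem loc_rate_of_bound {q : ℝ} (hn : 0 < n) (hr : 0 < r) (hv : 0 < v) (hQ : 0 ≤ vQ)
    (hq0 : 0 ≤ q) (hS : vS ≤ (16 * r ^ 2 * √v ^ 2 + vQ) / (16 * r ^ 2 * n ^ 2)) (hd1 : d ≤ 1)
    (hq : q ≤ 1 / √v + √vS / (2 / n * √v ^ 2))
    (hd : d ≤ 2 * √(q * vS) / (2 / n * √v ^ 2) + 2 / √v ^ 2) :
    d ≤ 6 * (vQ ^ (3 / 4 : ℝ) / (r ^ (3 / 2 : ℝ) * √v ^ 3) + 1 / √v ^ (3 / 2 : ℝ)) := by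
  have hb := sqrt_variance_div_le hn hr hv hQ hS
  have hc := sqrt_variance_rate_le hn hr hv hQ hS
  have hs := Real.sqrt_pos.2 hv
  rw [rpow_three_quarters hQ, rpow_three_halves hr.le, rpow_three_halves hs.le]
  set s := √v with hsd
  set a := √vQ / r with had
  have ha : 0 ≤ a := by positivity
  have hss : √s * √s = s := Real.mul_self_sqrt hs.le
  have hs2 : 0 < √s := Real.sqrt_pos.2 hs
  have ea : √vQ * √(√vQ) / (r * √r * s ^ 3) = a * √a / s ^ 3 := by
    rw [had, Real.sqrt_div (Real.sqrt_nonneg _)]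
    have := Real.sqrt_pos.2 hr
    field_simp
  have es : 1 / (s * √s) = s * √s / s ^ 3 := by
    rw [div_eq_div_iff (by positivity) (by positivity)]
    calc 1 * s ^ 3 = s ^ 2 * s := by ring
      _ = s ^ 2 * (√s * √s) := by rw [hss]
      _ = _ := by ring
  have hA : 0 ≤ √vQ * √(√vQ) / (r * √r * s ^ 3) := by positivity
  have hB : 0 < 1 / (s * √s) := by positivity
  rcases le_total 1 s with h | h
  · have hs1 : √s ≤ s := by
      rw [Real.sqrt_le_iff]
      constructor <;> nlinarith
    have h3 : 2 / s ^ 2 ≤ 2 * (1 / (s * √s)) := by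
      rw [mul_one_div]
      gcongr
      nlinarith
    have hq2 : q ≤ 2 * (s + a) / s ^ 2 := by
      have e : 2 * (s + a) / s ^ 2 = 2 * (1 / s) + 2 * (√vQ / (r * s ^ 2)) := by
        rw [had]; field_simp
      have : 0 ≤ √vQ / (r * s ^ 2) := by positivity
      linarith
    have h4 : 2 * √(q * vS) / (2 / n * s ^ 2) ≤ 4 * (s * √s + a * √a) / s ^ 3 := by
      have h5 : √(q * vS) ≤ √(2 * (s + a)) / s * ((s + a) / n) := by
        rw [Real.sqrt_mul hq0]
        have h6 : √q ≤ √(2 * (s + a)) / s := by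
          refine (Real.sqrt_le_sqrt hq2).trans_eq ?_
          rw [Real.sqrt_div (by positivity), Real.sqrt_sq hs.le]
        have h7 : √vS ≤ (s + a) / n := hc.trans (by gcongr; linarith)
        gcongr
      calc _ ≤ 2 * (√(2 * (s + a)) / s * ((s + a) / n)) / (2 / n * s ^ 2) := by gcongr
        _ = ((s + a) * √(2 * (s + a))) / s ^ 3 := by field_simp
        _ ≤ _ := by
          exact div_le_div_of_nonneg_right (add_mul_sqrt_add_le hs.le ha) (by positivity)
    have h8 : 4 * (s * √s + a * √a) / s ^ 3 =
        4 * (√vQ * √(√vQ) / (r * √r * s ^ 3)) + 4 * (1 / (s * √s)) := by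
      rw [ea, es]; ring
    linarith
  · have h3 : 1 ≤ 1 / (s * √s) := by
      rw [le_div_iff₀ (by positivity), one_mul]
      exact mul_le_one₀ h hs2.le (Real.sqrt_le_one.2 h)
    linarith

end Rates

/-! ### Trivial bounds on the distances -/

section Distances

variable (P Q : Measure ℤ) [IsProbabilityMeasure P] [IsProbabilityMeasure Q]

theorem abs_measureReal_sub_measureReal_le_one (A : Set ℤ) : |P.real A - Q.real A| ≤ 1 := by
  have h1 : P.real A ≤ 1 := measureReal_le_one
  have h2 : Q.real A ≤ 1 := measureReal_le_one
  have h3 : 0 ≤ P.real A := measureReal_nonneg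
  have h4 : 0 ≤ Q.real A := measureReal_nonneg
  rw [abs_le]
  constructor <;> linarith

theorem tvDistInt_le_one : tvDistInt P Q ≤ 1 :=
  ciSup_le (abs_measureReal_sub_measureReal_le_one P Q)

theorem locDistInt_le_one : locDistInt P Q ≤ 1 :=
  ciSup_le fun k => abs_measureReal_sub_measureReal_le_one P Q {k}

end Distances

/-! ### The chain in equilibrium: laws, regression and variance of the up-rate -/

namespace IsEquilibriumAntiVoter

variable {V : Type*} [Fintype V] [DecidableEq V] {G : SimpleGraph V} [DecidableRel G.Adj]
  {Ω : Type*} [MeasurableSpace Ω] {P : Measure Ω} {J : ℕ → Ω → V → Bool}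

theorem measureReal_pair (hJ : IsEquilibriumAntiVoter G P J) (x y : V → Bool) :
    P.real {ω | J 0 ω = x ∧ J 1 ω = y} =
      (P.map (J 0)).real {x} * antiVoterTransition G x y := by
  have h := hJ.markov 0 fun s => if s = 0 then x else y
  rw [map_measureReal_apply (hJ.measurable 0) (measurableSet_singleton x)]
  have e1 : {ω | ∀ s ≤ 0 + 1, J s ω = if s = 0 then x else y} = {ω | J 0 ω = x ∧ J 1 ω = y} := by
    ext ω
    simp only [Set.mem_ofPred_eq]
    constructor
    · intro h
      exact ⟨by simpa using h 0 (by omega), by simpa using h 1 (by omega)⟩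
    · rintro ⟨h0, h1⟩ s hs
      interval_cases s
      · simpa using h0
      · simpa using h1
  have e2 : {ω | ∀ s ≤ 0, J s ω = if s = 0 then x else y} = J 0 ⁻¹' {x} := by
    ext ω
    simp
  rw [e1, e2] at h
  simpa using h

variable [IsProbabilityMeasure P]

theorem integral_comp (hJ : IsEquilibriumAntiVoter G P J) (f : (V → Bool) → ℝ) :
    ∫ ω, f (J 0 ω) ∂P = ∑ x, (P.map (J 0)).real {x} * f x := by
  have : IsProbabilityMeasure (P.map (J 0)) :=
    Measure.isProbabilityMeasure_map (hJ.measurable 0).aemeasurable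
  rw [← integral_map (hJ.measurable 0).aemeasurable (Measurable.of_discrete.aestronglyMeasurable),
    integral_fintype (Integrable.of_finite)]
  simp

theorem integral_comp_pair (hJ : IsEquilibriumAntiVoter G P J)
    (F : (V → Bool) → (V → Bool) → ℝ) :
    ∫ ω, F (J 0 ω) (J 1 ω) ∂P =
      ∑ x, (P.map (J 0)).real {x} * ∑ y, antiVoterTransition G x y * F x y := by
  have hm : Measurable fun ω => (J 0 ω, J 1 ω) := (hJ.measurable 0).prodMk (hJ.measurable 1)
  have : IsProbabilityMeasure (P.map fun ω => (J 0 ω, J 1 ω)) :=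
    Measure.isProbabilityMeasure_map hm.aemeasurable
  have h : ∫ ω, F (J 0 ω) (J 1 ω) ∂P =
      ∫ z, F z.1 z.2 ∂(P.map fun ω => (J 0 ω, J 1 ω)) :=
    (integral_map hm.aemeasurable (Measurable.of_discrete (f := fun z : (V → Bool) × (V → Bool) =>
      F z.1 z.2)).aestronglyMeasurable).symm
  rw [h, integral_fintype (Integrable.of_finite), Fintype.sum_prod_type]
  refine Finset.sum_congr rfl fun x _ => ?_
  rw [Finset.mul_sum]
  refine Finset.sum_congr rfl fun y _ => ?_
  rw [map_measureReal_apply hm (measurableSet_singleton _), smul_eq_mul, ← mul_assoc,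
    ← hJ.measureReal_pair]
  congr 2
  ext ω
  simp

theorem memLp_comp (hJ : IsEquilibriumAntiVoter G P J) (F : (V → Bool) → (V → Bool) → ℝ)
    (q : ENNReal) : MemLp (fun ω => F (J 0 ω) (J 1 ω)) q P := by
  have hmeas : Measurable fun ω => F (J 0 ω) (J 1 ω) :=
    (Measurable.of_discrete (f := fun x : (V → Bool) × (V → Bool) => F x.1 x.2)).comp
      ((hJ.measurable 0).prodMk (hJ.measurable 1))
  refine MemLp.of_bound hmeas.aestronglyMeasurable (∑ a, ∑ b, ‖F a b‖) (ae_of_all _ fun ω => ?_)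
  exact (Finset.single_le_sum (f := fun b => ‖F (J 0 ω) b‖) (fun _ _ => norm_nonneg _)
    (Finset.mem_univ (J 1 ω))).trans
    (Finset.single_le_sum (f := fun a => ∑ b, ‖F a b‖)
      (fun _ _ => Finset.sum_nonneg fun _ _ => norm_nonneg _) (Finset.mem_univ (J 0 ω)))

theorem integrable_comp (hJ : IsEquilibriumAntiVoter G P J)
    (F : (V → Bool) → (V → Bool) → ℝ) : Integrable (fun ω => F (J 0 ω) (J 1 ω)) P :=
  memLp_one_iff_integrable.1 (hJ.memLp_comp F 1)

theorem sum_law_mul_transition (hJ : IsEquilibriumAntiVoter G P J) (y : V → Bool) :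
    ∑ x, (P.map (J 0)).real {x} * antiVoterTransition G x y = (P.map (J 0)).real {y} := by
  have h := hJ.integral_comp_pair fun _ z => if z = y then 1 else 0
  simp only [mul_ite, mul_one, mul_zero, Finset.sum_ite_eq', Finset.mem_univ, if_true] at h
  rw [← h]
  have hl := congrArg (fun ν : Measure (V → Bool) => ν.real {y}) (hJ.stationary 1)
  rw [← hl, map_measureReal_apply (hJ.measurable 1) (measurableSet_singleton y),
    ← integral_indicator_one (hJ.measurable 1 (measurableSet_singleton y))]
  congr 1
  ext ω
  by_cases hω : J 1 ω = y <;> simp [Set.indicator, hω]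

theorem sum_law (hJ : IsEquilibriumAntiVoter G P J) : ∑ x, (P.map (J 0)).real {x} = 1 := by
  have h := hJ.integral_comp fun _ => 1
  simpa using h.symm

theorem ae_step (hJ : IsEquilibriumAntiVoter G P J) :
    ∀ᵐ ω ∂P, AntiVoterStep G (J 0 ω) (J 1 ω) := by
  have h : ∀ z : (V → Bool) × (V → Bool), ∀ᵐ ω ∂P,
      J 0 ω = z.1 ∧ J 1 ω = z.2 → AntiVoterStep G z.1 z.2 := fun z => by
    by_cases hz : AntiVoterStep G z.1 z.2
    · exact ae_of_all _ fun _ _ => hz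
    · have h0 : antiVoterTransition G z.1 z.2 = 0 := by
        by_contra hne
        exact hz (antiVoterStep_of_transition_ne_zero hne)
      have h1 := hJ.measureReal_pair z.1 z.2
      rw [h0, mul_zero, measureReal_eq_zero_iff] at h1
      filter_upwards [measure_eq_zero_iff_ae_notMem.1 h1] with ω hω hω'
      exact absurd hω' hω
  filter_upwards [ae_all_iff.2 h] with ω hω
  exact hω (J 0 ω, J 1 ω) ⟨rfl, rfl⟩

/-- A tower property: the statistic `w (J 0)` is coarser than `J 0`, so `F` may first be averaged
over the transition from `J 0`. -/
theorem condExp_comp_pair (hJ : IsEquilibriumAntiVoter G P J) (w : (V → Bool) → ℤ)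
    (F : (V → Bool) → (V → Bool) → ℝ) :
    P[fun ω => F (J 0 ω) (J 1 ω) | MeasurableSpace.comap (fun ω => w (J 0 ω)) ⊤] =ᵐ[P]
      P[fun ω => ∑ y, antiVoterTransition G (J 0 ω) y * F (J 0 ω) y |
        MeasurableSpace.comap (fun ω => w (J 0 ω)) ⊤] := by
  have hw : Measurable fun ω => w (J 0 ω) :=
    (Measurable.of_discrete (f := w)).comp (hJ.measurable 0)
  have hle := hw.comap_le
  have hf := hJ.integrable_comp fun x _ => ∑ y, antiVoterTransition G x y * F x y
  refine (ae_eq_condExp_of_forall_setIntegral_eq hle (hJ.integrable_comp F)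
    (fun s _ _ => integrable_condExp.integrableOn) (fun s hs _ => ?_)
    stronglyMeasurable_condExp.aestronglyMeasurable).symm
  rw [setIntegral_condExp hle hf hs]
  obtain ⟨A, -, rfl⟩ := hs
  have hA : MeasurableSet ((fun ω => w (J 0 ω)) ⁻¹' A) :=
    hw (DiscreteMeasurableSpace.forall_measurableSet A)
  rw [← integral_indicator hA, ← integral_indicator hA]
  classical
  have e1 := hJ.integral_comp fun x =>
    if w x ∈ A then ∑ y, antiVoterTransition G x y * F x y else 0
  have e2 := hJ.integral_comp_pair fun x y => if w x ∈ A then F x y else 0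
  refine Eq.trans (Eq.trans ?_ (e1.trans ?_)) (e2.symm.trans ?_)
  · congr 1
  · refine Finset.sum_congr rfl fun x _ => ?_
    split_ifs <;> simp
  · congr 1

end IsEquilibriumAntiVoter

theorem SimpleGraph.IsRegularOfDegree.pos_of_not_isBipartite {V : Type*} [Fintype V]
    {G : SimpleGraph V} [DecidableRel G.Adj] {r : ℕ} (hreg : G.IsRegularOfDegree r)
    (hbip : ¬ G.IsBipartite) : 0 < r := by
  by_contra hr
  refine hbip (SimpleGraph.Coloring.colorable (α := Fin 2) ⟨fun _ => 0, fun {i j} hij => ?_⟩)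
  have hij : G.Adj i j := hij
  have := (G.degree_pos_iff_exists_adj i).2 ⟨j, hij⟩
  rw [hreg.degree_eq] at this
  exact absurd this hr

/-- This is what makes `λ = 2 / n` less than `1`. -/
theorem SimpleGraph.two_lt_card_of_not_isBipartite {V : Type*} [Fintype V] {G : SimpleGraph V}
    (hbip : ¬ G.IsBipartite) : 2 < Fintype.card V := by
  by_contra! h
  exact hbip (G.colorable_of_fintype.mono h)

namespace IsEquilibriumAntiVoter

variable {V : Type*} [Fintype V] [DecidableEq V] {G : SimpleGraph V} [DecidableRel G.Adj]
  {Ω : Type*} [MeasurableSpace Ω] {P : Measure Ω} {J : ℕ → Ω → V → Bool} {r : ℕ}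

theorem measurable_oneCount (hJ : IsEquilibriumAntiVoter G P J) (t : ℕ) :
    Measurable fun ω => oneCount (J t ω) :=
  (Measurable.of_discrete (f := oneCount)).comp (hJ.measurable t)

theorem map_oneCount (hJ : IsEquilibriumAntiVoter G P J) (t : ℕ) :
    P.map (fun ω => oneCount (J t ω)) = P.map fun ω => oneCount (J 0 ω) := by
  have e : ∀ s, P.map (fun ω => oneCount (J s ω)) = (P.map (J s)).map oneCount := fun s =>
    (Measure.map_map (g := oneCount) Measurable.of_discrete (hJ.measurable s)).symm
  rw [e, e, hJ.stationary t]

variable [IsProbabilityMeasure P]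

theorem ae_oneCount_step (hJ : IsEquilibriumAntiVoter G P J) :
    ∀ᵐ ω ∂P, oneCount (J 1 ω) - oneCount (J 0 ω) = -1 ∨ oneCount (J 1 ω) - oneCount (J 0 ω) = 0 ∨
      oneCount (J 1 ω) - oneCount (J 0 ω) = 1 := by
  filter_upwards [hJ.ae_step] with ω hω
  obtain ⟨i, j, -, h⟩ := hω
  rw [h, oneCount_update]
  cases J 0 ω i <;> cases J 0 ω j <;> simp

variable [Nonempty V]

theorem integral_totalSpin (hJ : IsEquilibriumAntiVoter G P J) (hreg : G.IsRegularOfDegree r)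
    (hr : 0 < r) : ∫ ω, totalSpin (J 0 ω) ∂P = 0 := by
  rw [hJ.integral_comp, sum_stationary_mul_totalSpin hreg hr hJ.sum_law_mul_transition]

theorem integral_oneCount (hJ : IsEquilibriumAntiVoter G P J) (hreg : G.IsRegularOfDegree r)
    (hr : 0 < r) : ∫ ω, (oneCount (J 0 ω) : ℝ) ∂P = Fintype.card V / 2 := by
  simp_rw [oneCount_eq_totalSpin]
  rw [integral_div, integral_add (integrable_const _) (hJ.integrable_comp fun x _ => totalSpin x),
    hJ.integral_totalSpin hreg hr]
  simp

theorem variance_oneCount (hJ : IsEquilibriumAntiVoter G P J) (hreg : G.IsRegularOfDegree r)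
    (hr : 0 < r) : variance (fun ω => (oneCount (J 0 ω) : ℝ)) P =
      (∫ ω, totalSpin (J 0 ω) ^ 2 ∂P) / 4 := by
  rw [variance_eq_integral (hJ.integrable_comp fun x _ => (oneCount x : ℝ)).1.aemeasurable,
    hJ.integral_oneCount hreg hr, ← integral_div]
  congr 1
  ext ω
  rw [oneCount_eq_totalSpin]
  ring

theorem variance_oneCount_pos (hJ : IsEquilibriumAntiVoter G P J) (hreg : G.IsRegularOfDegree r)
    (hr : 0 < r) (hbip : ¬ G.IsBipartite) :
    0 < variance (fun ω => (oneCount (J 0 ω) : ℝ)) P := by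
  rw [hJ.variance_oneCount hreg hr, hJ.integral_comp fun x => totalSpin x ^ 2]
  have := sum_stationary_mul_totalSpin_sq_pos hreg hr hbip (fun _ => measureReal_nonneg)
    hJ.sum_law hJ.sum_law_mul_transition
  positivity

theorem condExp_oneCount (hJ : IsEquilibriumAntiVoter G P J) (hreg : G.IsRegularOfDegree r)
    (hr : 0 < r) :
    P[fun ω => (oneCount (J 1 ω) : ℝ) - Fintype.card V / 2 |
      MeasurableSpace.comap (fun ω => oneCount (J 0 ω)) ⊤] =ᵐ[P]
    fun ω => (1 - 2 / (Fintype.card V : ℝ)) * ((oneCount (J 0 ω) : ℝ) - Fintype.card V / 2) := by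
  have h := hJ.condExp_comp_pair oneCount fun _ y => (oneCount y : ℝ) - Fintype.card V / 2
  have e : ∀ x : V → Bool, ∑ y, antiVoterTransition G x y *
      ((oneCount y : ℝ) - Fintype.card V / 2) =
      (1 - 2 / (Fintype.card V : ℝ)) * ((oneCount x : ℝ) - Fintype.card V / 2) := fun x => by
    have h1 : ∀ y : V → Bool, (oneCount y : ℝ) - Fintype.card V / 2 = totalSpin y / 2 := fun y => by
      rw [oneCount_eq_totalSpin]; ring
    simp_rw [h1, ← mul_div_assoc]
    rw [← Finset.sum_div, sum_antiVoterTransition_mul_totalSpin hreg hr]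
  simp_rw [e] at h
  have hle : MeasurableSpace.comap (fun ω => oneCount (J 0 ω)) ⊤ ≤ ‹MeasurableSpace Ω› :=
    (hJ.measurable_oneCount 0).comap_le
  have hsm : StronglyMeasurable[MeasurableSpace.comap (fun ω => oneCount (J 0 ω)) ⊤]
      fun ω => (1 - 2 / (Fintype.card V : ℝ)) *
        ((oneCount (J 0 ω) : ℝ) - Fintype.card V / 2) :=
    ((Measurable.of_discrete (f := fun w : ℤ => (1 - 2 / (Fintype.card V : ℝ)) *
      ((w : ℝ) - Fintype.card V / 2))).comp (comap_measurable _)).stronglyMeasurable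
  rwa [condExp_of_stronglyMeasurable hle hsm (hJ.integrable_comp fun x _ =>
    (1 - 2 / (Fintype.card V : ℝ)) * ((oneCount x : ℝ) - Fintype.card V / 2))] at h

/-- The variances add because the total spin is centred and uncorrelated with the neighbour product
sum. -/
theorem variance_up_rate (hJ : IsEquilibriumAntiVoter G P J) (hreg : G.IsRegularOfDegree r)
    (hr : 0 < r) :
    variance (fun ω => 1 / 4 - totalSpin (J 0 ω) / (2 * Fintype.card V) +
      neighbourProductSum G (J 0 ω) / (4 * Fintype.card V * r)) P =
    (16 * (r : ℝ) ^ 2 * variance (fun ω => (oneCount (J 0 ω) : ℝ)) P +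
      variance (fun ω => neighbourProductSum G (J 0 ω)) P) /
      (16 * (r : ℝ) ^ 2 * (Fintype.card V : ℝ) ^ 2) := by
  have hn : (Fintype.card V : ℝ) ≠ 0 := by exact_mod_cast Fintype.card_ne_zero
  have hr' : (r : ℝ) ≠ 0 := by exact_mod_cast hr.ne'
  set n : ℝ := (Fintype.card V : ℝ)
  have hi : ∀ f : (V → Bool) → ℝ, Integrable (fun ω => f (J 0 ω)) P := fun f =>
    hJ.integrable_comp fun x _ => f x
  have hY := hJ.integral_totalSpin hreg hr
  have hYQ : ∫ ω, totalSpin (J 0 ω) * neighbourProductSum G (J 0 ω) ∂P = 0 := by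
    rw [hJ.integral_comp fun x => totalSpin x * neighbourProductSum G x]
    exact sum_stationary_mul_totalSpin_mul_neighbourProductSum hreg hr
      (fun _ => measureReal_nonneg) hJ.sum_law_mul_transition
  rw [hJ.variance_oneCount hreg hr,
    variance_eq_integral (hi fun x => 1 / 4 - totalSpin x / (2 * n) +
      neighbourProductSum G x / (4 * n * r)).1.aemeasurable,
    variance_eq_integral (hi (neighbourProductSum G)).1.aemeasurable]
  set q := ∫ ω, neighbourProductSum G (J 0 ω) ∂P with hq
  have hT : ∫ ω, (1 / 4 - totalSpin (J 0 ω) / (2 * n) +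
      neighbourProductSum G (J 0 ω) / (4 * n * r)) ∂P = 1 / 4 + q / (4 * n * r) := by
    rw [integral_add (hi fun x => 1 / 4 - totalSpin x / (2 * n))
        (hi fun x => neighbourProductSum G x / (4 * n * r)),
      integral_sub (integrable_const _) (hi fun x => totalSpin x / (2 * n)), integral_div,
      integral_div, hY]
    simp [hq, integral_div]
  have hpt : ∀ x : V → Bool, (1 / 4 - totalSpin x / (2 * n) +
      neighbourProductSum G x / (4 * n * r) - (1 / 4 + q / (4 * n * r))) ^ 2 =
      1 / (4 * n ^ 2) * totalSpin x ^ 2 +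
      1 / (16 * n ^ 2 * r ^ 2) * (neighbourProductSum G x - q) ^ 2 -
      1 / (4 * n ^ 2 * r) * (totalSpin x * neighbourProductSum G x) +
      q / (4 * n ^ 2 * r) * totalSpin x := fun x => by
    field_simp
    ring
  rw [hT]
  simp_rw [hpt]
  rw [integral_add (hi fun x => 1 / (4 * n ^ 2) * totalSpin x ^ 2 +
      1 / (16 * n ^ 2 * r ^ 2) * (neighbourProductSum G x - q) ^ 2 -
      1 / (4 * n ^ 2 * r) * (totalSpin x * neighbourProductSum G x))
      (hi fun x => q / (4 * n ^ 2 * r) * totalSpin x),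
    integral_sub (hi fun x => 1 / (4 * n ^ 2) * totalSpin x ^ 2 +
      1 / (16 * n ^ 2 * r ^ 2) * (neighbourProductSum G x - q) ^ 2)
      (hi fun x => 1 / (4 * n ^ 2 * r) * (totalSpin x * neighbourProductSum G x)),
    integral_add (hi fun x => 1 / (4 * n ^ 2) * totalSpin x ^ 2)
      (hi fun x => 1 / (16 * n ^ 2 * r ^ 2) * (neighbourProductSum G x - q) ^ 2),
    integral_const_mul, integral_const_mul, integral_const_mul, integral_const_mul, hY, hYQ]
  field_simp
  ring

theorem variance_condExp_up_le (hJ : IsEquilibriumAntiVoter G P J) (hreg : G.IsRegularOfDegree r)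
    (hr : 0 < r) :
    variance (P[Set.indicator {ω | oneCount (J 1 ω) = oneCount (J 0 ω) + 1} (fun _ => (1 : ℝ)) |
      MeasurableSpace.comap (fun ω => oneCount (J 0 ω)) ⊤]) P ≤
    (16 * (r : ℝ) ^ 2 * variance (fun ω => (oneCount (J 0 ω) : ℝ)) P +
      variance (fun ω => neighbourProductSum G (J 0 ω)) P) /
      (16 * (r : ℝ) ^ 2 * (Fintype.card V : ℝ) ^ 2) := by
  have hind : Set.indicator {ω | oneCount (J 1 ω) = oneCount (J 0 ω) + 1} (fun _ => (1 : ℝ)) =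
      fun ω => if oneCount (J 1 ω) = oneCount (J 0 ω) + 1 then 1 else 0 := by
    ext ω; simp [Set.indicator]
  have h := hJ.condExp_comp_pair oneCount fun x y => if oneCount y = oneCount x + 1 then 1 else 0
  simp_rw [sum_antiVoterTransition_mul_up hreg hr] at h
  rw [hind, variance_congr h, ← hJ.variance_up_rate hreg hr]
  have hle : MeasurableSpace.comap (fun ω => oneCount (J 0 ω)) ⊤ ≤ ‹MeasurableSpace Ω› :=
    (hJ.measurable_oneCount 0).comap_le
  -- Law of total variance: `S` is the conditional expectation given `W` of the up-rate given `J 0`,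
  -- so its variance is no larger.
  have ht := integral_condVar_add_variance_condExp hle
    (hJ.memLp_comp (fun x _ => 1 / 4 - totalSpin x / (2 * Fintype.card V) +
      neighbourProductSum G x / (4 * Fintype.card V * r)) 2)
  have h0 : 0 ≤ ∫ ω, (Var[fun ω => 1 / 4 - totalSpin (J 0 ω) / (2 * Fintype.card V) +
      neighbourProductSum G (J 0 ω) / (4 * Fintype.card V * r); P |
      MeasurableSpace.comap (fun ω => oneCount (J 0 ω)) ⊤]) ω ∂P := by
    refine integral_nonneg_of_ae ?_
    exact condExp_nonneg (ae_of_all _ fun ω => sq_nonneg _)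
  linarith

end IsEquilibriumAntiVoter

end

/-! ### Assembly -/

theorem theorem4p5 :
    ∃ C : ℝ, ∀ (V : Type*) [Fintype V] [DecidableEq V] (G : SimpleGraph V) [DecidableRel G.Adj]
      (n r : ℕ) (Ω : Type*) [MeasurableSpace Ω] (P : Measure Ω) [IsProbabilityMeasure P]
      (J : ℕ → Ω → V → Bool),
      Fintype.card V = n →
      G.IsRegularOfDegree r →
      ¬ G.IsBipartite →
      ¬ Nonempty (G ≃g SimpleGraph.cycleGraph n) →
      IsEquilibriumAntiVoter G P J →
      let W : Ω → ℤ := fun ω => oneCount (J 0 ω)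
      let W' : Ω → ℤ := fun ω => oneCount (J 1 ω)
      let Q : Ω → ℝ := fun ω => neighbourProductSum G (J 0 ω)
      let μ : ℝ := ∫ ω, (W ω : ℝ) ∂P
      let varW : ℝ := variance (fun ω => (W ω : ℝ)) P
      let σ : ℝ := Real.sqrt varW
      let lam : ℝ := 2 / (n : ℝ)
      -- the conditional probability of `W' = W + 1` given `W`
      let S : Ω → ℝ :=
        P[Set.indicator {ω | W' ω = W ω + 1} (fun _ => (1 : ℝ)) | MeasurableSpace.comap W ⊤]
      let varS : ℝ := variance S P
      let varQ : ℝ := variance Q P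
      let qmax : ℝ := maxPointProb (P.map W)
      -- the set-up, with `R = 0` and `λ = 2 / n`
      0 < σ ∧ 0 < lam ∧ lam < 1 ∧
      P.map (fun ω => (W ω, W' ω)) = P.map (fun ω => (W' ω, W ω)) ∧
      (P[fun ω => (W' ω : ℝ) - μ | MeasurableSpace.comap W ⊤] =ᵐ[P] fun ω => (1 - lam) * ((W ω : ℝ) - μ)) ∧
      (∀ᵐ ω ∂P, W' ω - W ω = -1 ∨ W' ω - W ω = 0 ∨ W' ω - W ω = 1) ∧
      -- the two general bounds, with `R = 0` and `λ = 2 / n`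
      tvDistInt (P.map W) (translatedPoisson μ (σ ^ 2)) ≤
        Real.sqrt varS / (lam * σ ^ 2) + 2 / σ ^ 2 ∧
      locDistInt (P.map W) (translatedPoisson μ (σ ^ 2)) ≤
        2 * Real.sqrt (qmax * varS) / (lam * σ ^ 2) + 2 / σ ^ 2 ∧
      -- the variance bound
      varS ≤ (16 * (r : ℝ) ^ 2 * σ ^ 2 + varQ) / (16 * (r : ℝ) ^ 2 * (n : ℝ) ^ 2) ∧
      -- the rates, with an absolute constant
      tvDistInt (P.map W) (translatedPoisson μ (σ ^ 2)) ≤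
        C * (Real.sqrt varQ / ((r : ℝ) * σ ^ 2) + 1 / σ) ∧
      locDistInt (P.map W) (translatedPoisson μ (σ ^ 2)) ≤
        C * (varQ ^ (3 / 4 : ℝ) / ((r : ℝ) ^ (3 / 2 : ℝ) * σ ^ 3) + 1 / σ ^ (3 / 2 : ℝ)) := by
  -- The local rate needs `4` from the main term and `2` from the term `2 / σ²`; the total variation
  -- rate needs less.
  refine ⟨6, ?_⟩
  intro V _ _ G _ n r Ω _ P _ J hcard hreg hbip _ hJ W W' Q μ varW σ lam S varS varQ qmax
  subst hcard
  have hr : 0 < r := hreg.pos_of_not_isBipartite hbip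
  have hn2 : 2 < Fintype.card V := SimpleGraph.two_lt_card_of_not_isBipartite hbip
  have : Nonempty V := Fintype.card_pos_iff.1 (by omega)
  have hn2' : (2 : ℝ) < Fintype.card V := by exact_mod_cast hn2
  have hn0 : (0 : ℝ) < Fintype.card V := by linarith
  have hr0 : (0 : ℝ) < r := by exact_mod_cast hr
  have hW : Measurable W := hJ.measurable_oneCount 0
  have hW' : Measurable W' := hJ.measurable_oneCount 1
  have hμ : μ = Fintype.card V / 2 := hJ.integral_oneCount hreg hr
  have hv : 0 < varW := hJ.variance_oneCount_pos hreg hr hbip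
  have hσ : 0 < σ := Real.sqrt_pos.2 hv
  have hσ2 : σ ^ 2 = varW := Real.sq_sqrt hv.le
  have hlam : 0 < lam := by positivity
  have hlam1 : lam < 1 := (div_lt_one hn0).2 hn2'
  have hstep := hJ.ae_oneCount_step
  have hex := map_prodMk_comm_of_skipFree hW hW' (hJ.map_oneCount 1) hstep
  have hregr : P[fun ω => (W' ω : ℝ) - μ | MeasurableSpace.comap W ⊤] =ᵐ[P]
      fun ω => (1 - lam) * ((W ω : ℝ) - μ) := by
    rw [hμ]
    exact hJ.condExp_oneCount hreg hr
  have hpair : IsSteinPair P W S μ lam := isSteinPair_of_exchangeable hW hW'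
    (fun ω => abs_oneCount_le (J 0 ω)) (fun ω => abs_oneCount_le (J 1 ω)) hex hstep hlam hregr
  have htv := hpair.tvDistInt_le (v := σ ^ 2) hσ2.symm (by positivity)
  have hloc := hpair.locDistInt_le (v := σ ^ 2) hσ2.symm (by positivity)
  have hS : varS ≤ (16 * (r : ℝ) ^ 2 * σ ^ 2 + varQ) /
      (16 * (r : ℝ) ^ 2 * (Fintype.card V : ℝ) ^ 2) := by
    rw [hσ2]
    exact hJ.variance_condExp_up_le hreg hr
  have hQ : 0 ≤ varQ := variance_nonneg _ _
  have hq0 : 0 ≤ qmax := measureReal_nonneg.trans (hpair.pointProb_le_maxPointProb 0)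
  have hq : qmax ≤ 1 / σ + √varS / (lam * σ ^ 2) := by
    rw [hσ2]
    exact hpair.maxPointProb_le hv
  have : IsProbabilityMeasure (P.map W) := Measure.isProbabilityMeasure_map hW.aemeasurable
  exact ⟨hσ, hlam, hlam1, hex, hregr, hstep, htv, hloc, hS,
    tv_rate_of_bound hn0 hr0 hv hQ hS (tvDistInt_le_one _ _) htv,
    loc_rate_of_bound hn0 hr0 hv hQ hq0 hS (locDistInt_le_one _ _) hq hloc⟩
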